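/- **Setting.** A single-commodity bottleneck routing game with unit demands consists of a finite directed graph $(V,A)$ (parallel arcs and loops are allowed), a source $s$ and a sink $t\ne s$ reachable from $s$, $n\ge 1$ players, and for each arc $a\in A$ a non-negative non-decreasing cost function $c_a:[0,n]\to\mathbb{R}$. The strategies of every player are the arc sets of the simple $s$-$t$-paths. For a strategy profile $x$ let $n_a(x)$ be the number of players using $a$; the private cost of player $i$ is $\pi_i(x)=\max_{a\in x_i}c_a(n_a(x))$. An improving move is a pair $(x,z)$ of profiles for which some non-empty coalition $S$ satisfies $z_j=x_j$ for $j\notin S$ and $\pi_i(z)<\pi_i(x)$ for all $i\in S$. A profile $x$ is a strong Nash equilibrium (SNE) if no improving move starts at $x$. A function $P$ on profiles is a generalized strong ordinal potential if $P(z)<P(x)$ for every improving move $(x,z)$. Running times refer to a unit cost random access machine (with natural number and real memory cells; $+,-,\cdot$ on natural numbers, with subtraction truncated at $0$, and $+,-,\cdot,/$ on reals; comparisons; no real constants and no rounding), on which each operation takes one time unit regardless of the size or precision of the operands. The input is the graph, $s$, $t$, $n$, a bound $C$ and the table of values $c_a(k)$, $a\in A$, $0\le k\le n$; the input size is $|V|+|A|+n$.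 The output is the incidence matrix of players and arcs. **Proposition.** Consider the class of all such games in which every $c_a$ is convex and $c_a\le C$ on $[0,n]$, where $C\ge1$ is an integer that is at most $p(|V|+|A|+n)$ for a fixed polynomial $p$. There is an algorithm (which can be chosen independently of $p$) that, for every game in this class, computes an SNE $x^*$ in time polynomial in the input size. Moreover, $x^*$ minimizes a convex potential over integral flows, in the following sense. Let $\delta>0$ be such that any two distinct values among the numbers $c_a(k)$, $a\in A$, $1\le k\le n$, differ by at least $\delta$, and let $M\in\mathbb{N}$ with $M>\log(n|A|)\,C/\delta$. Then 1. for each $a\in A$ the function $y\mapsto (c_a(y)/C)^M\,y$ is convex on $[0,n]$; 2. $x\mapsto\sum_{a\in A}(c_a(n_a(x))/C)^M\,n_a(x)$ is a generalized strong ordinal potential of the game; 3. $(n_a(x^*))_{a\in A}$ minimizes $\sum_{a\in A}(c_a(f_a)/C)^M f_a$ over all integral $s$-$t$-flows $f$ of value $n$ with $0\le f_a\le n$ for all $a\in A$. -/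

import Mathlib

/-! ## Strategic games (cost minimization) -/

/-- `(x, z)` is an improving move of the coalition `S` in the game with private costs `π`:
`S` is non-empty, players outside `S` keep their strategies, and every player of `S` strictly
decreases her private cost. -/
def IsImprovingMove {N : Type} {X : N → Type} (π : (∀ i, X i) → N → ℝ) (S : Finset N)
    (x z : ∀ i, X i) : Prop :=
  S.Nonempty ∧ (∀ j, j ∉ S → z j = x j) ∧ ∀ i ∈ S, π z i < π x i

/-- Strong Nash equilibrium: no coalition has an improving move. -/
def IsSNE {N : Type} {X : N → Type} (π : (∀ i, X i) → N → ℝ) (x : ∀ i, X i) : Prop :=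
  ∀ (S : Finset N) (z : ∀ i, X i), ¬ IsImprovingMove π S x z

/-- Generalized strong ordinal potential: it strictly decreases along every improving move. -/
def IsGenStrongOrdinalPotential {N : Type} {X : N → Type} (π : (∀ i, X i) → N → ℝ)
    (P : (∀ i, X i) → ℝ) : Prop :=
  ∀ (S : Finset N) (x z : ∀ i, X i), IsImprovingMove π S x z → P z < P x

/-! ## Single-commodity bottleneck routing games with unit demands -/

/-- A bottleneck routing game on a finite directed graph (parallel arcs and loops are allowed) in
which all players have unit demand and must be routed from the common source `s` to the common
sink `t`.  Only loads in `[0, n]` can occur (`n` is the number of players), so the arc-cost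
functions are only relevant on that interval. -/
structure BottleneckRoutingGame where
  numVertices : ℕ
  numArcs : ℕ
  numPlayers : ℕ
  /-- tail of an arc -/
  src : Fin numArcs → Fin numVertices
  /-- head of an arc -/
  tgt : Fin numArcs → Fin numVertices
  s : Fin numVertices
  t : Fin numVertices
  /-- load dependent arc costs -/
  cost : Fin numArcs → ℝ → ℝ
  players_pos : 0 < numPlayers
  source_ne_sink : s ≠ t
  cost_nonneg : ∀ a, ∀ y ∈ Set.Icc (0 : ℝ) numPlayers, 0 ≤ cost a y
  cost_mono : ∀ a, MonotoneOn (cost a) (Set.Icc (0 : ℝ) numPlayers)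
  /-- the sink is reachable from the source (strategy sets are non-empty) -/
  reachable : Relation.ReflTransGen (fun u v => ∃ a, src a = u ∧ tgt a = v) s t

namespace BottleneckRoutingGame

/-- The list of arcs is a walk from `u` to `v`. -/
def IsWalk (G : BottleneckRoutingGame) :
    Fin G.numVertices → List (Fin G.numArcs) → Fin G.numVertices → Prop
  | u, [], v => u = v
  | u, a :: l, v => G.src a = u ∧ G.IsWalk (G.tgt a) l v

/-- `P` is the set of arcs of a path (a walk without repeated vertices) from `s` to `t`. -/
def IsPath (G : BottleneckRoutingGame) (P : Finset (Fin G.numArcs)) : Prop :=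
  ∃ l : List (Fin G.numArcs),
    G.IsWalk G.s l G.t ∧ (G.s :: l.map G.tgt).Nodup ∧ l.toFinset = P

/-- The common strategy set of all players: the `s`-`t`-paths. -/
def Strategy (G : BottleneckRoutingGame) : Type := {P : Finset (Fin G.numArcs) // G.IsPath P}

/-- Strategy profiles. -/
abbrev Profile (G : BottleneckRoutingGame) : Type := Fin G.numPlayers → G.Strategy

theorem Strategy.arcs_nonempty {G : BottleneckRoutingGame} (P : G.Strategy) :
    P.1.Nonempty := by
  obtain ⟨P, l, hw, -, rfl⟩ := P
  cases l with
  | nil => exact absurd hw G.source_ne_sink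
  | cons a l => exact ⟨a, by simp⟩

/-- The number of players using the arc `a`. -/
def load (G : BottleneckRoutingGame) (x : G.Profile) (a : Fin G.numArcs) : ℕ :=
  (Finset.univ.filter fun i => a ∈ (x i).1).card

/-- Private cost: the maximum arc cost along the chosen path. -/
noncomputable def privateCost (G : BottleneckRoutingGame) (x : G.Profile)
    (i : Fin G.numPlayers) : ℝ :=
  (x i).1.sup' (x i).arcs_nonempty fun a => G.cost a (G.load x a)

/-- All arc-cost functions are convex. -/
def ConvexCosts (G : BottleneckRoutingGame) : Prop :=
  ∀ a, ConvexOn ℝ (Set.Icc (0 : ℝ) G.numPlayers) (G.cost a)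

/-- All arc-cost functions are bounded by `C`. -/
def CostsBoundedBy (G : BottleneckRoutingGame) (C : ℕ) : Prop :=
  ∀ a, ∀ y ∈ Set.Icc (0 : ℝ) G.numPlayers, G.cost a y ≤ C

/-- Input size, in the unit cost model: number of vertices, arcs and players. -/
def size (G : BottleneckRoutingGame) : ℕ := G.numVertices + G.numArcs + G.numPlayers

/-- `f` is an integral `s`-`t`-flow whose value is the number `n` of players, with arc flows in
`{0, …, n}`. -/
def IsIntegralFlow (G : BottleneckRoutingGame) (f : Fin G.numArcs → ℕ) : Prop :=
  (∀ a, f a ≤ G.numPlayers) ∧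
  ∀ v : Fin G.numVertices,
    (∑ a with G.src a = v, (f a : ℤ)) - ∑ a with G.tgt a = v, (f a : ℤ) =
      if v = G.s then (G.numPlayers : ℤ) else if v = G.t then -(G.numPlayers : ℤ) else 0

/-- The summand `(c_a(y) / C) ^ M * y` of the potential. -/
noncomputable def arcPotential (G : BottleneckRoutingGame) (C M : ℕ) (a : Fin G.numArcs)
    (y : ℝ) : ℝ :=
  (G.cost a y / C) ^ M * y

/-- The potential `∑_a (c_a(f_a) / C) ^ M * f_a`. -/
noncomputable def potential (G : BottleneckRoutingGame) (C M : ℕ)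
    (f : Fin G.numArcs → ℕ) : ℝ :=
  ∑ a, G.arcPotential C M a (f a)

/-- Distinct values of the arc costs at positive integral loads differ by at least `δ`. -/
def CostGap (G : BottleneckRoutingGame) (δ : ℝ) : Prop :=
  ∀ (a b : Fin G.numArcs) (k l : ℕ), 1 ≤ k → k ≤ G.numPlayers → 1 ≤ l → l ≤ G.numPlayers →
    G.cost a k ≠ G.cost b l → δ ≤ |G.cost a k - G.cost b l|

end BottleneckRoutingGame

/-! ## A unit cost random access machine over the reals

Programs of a small imperative language.  The memory consists of finitely many named arrays (a
program mentions only finitely many names) of natural numbers and of real numbers.  Every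
arithmetic operation, comparison and memory access costs one time unit, regardless of the size or
the precision of the operands.  There are no real constants and there is no rounding operation. -/

namespace RealRAM

/-- Memory: `nat A i` and `real A i` are the `i`-th cells of the arrays named `A`. -/
structure Memory where
  nat : ℕ → ℕ → ℕ
  real : ℕ → ℕ → ℝ

/-- Natural number expressions; subtraction is truncated at `0`. -/
inductive NExp where
  | const (k : ℕ)
  | get (A : ℕ) (i : NExp)
  | add (e₁ e₂ : NExp)
  | sub (e₁ e₂ : NExp)
  | mul (e₁ e₂ : NExp)

/-- Real number expressions; division by zero yields `0`. -/
inductive RExp where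
  | ofNat (e : NExp)
  | get (A : ℕ) (i : NExp)
  | add (e₁ e₂ : RExp)
  | sub (e₁ e₂ : RExp)
  | mul (e₁ e₂ : RExp)
  | div (e₁ e₂ : RExp)

/-- Tests. -/
inductive Test where
  | nle (e₁ e₂ : NExp)
  | rle (e₁ e₂ : RExp)
  | not (b : Test)
  | and (b₁ b₂ : Test)

/-- Programs. -/
inductive Program where
  | skip
  | nset (A : ℕ) (i e : NExp)
  | rset (A : ℕ) (i : NExp) (e : RExp)
  | seq (p q : Program)
  | branch (b : Test) (p q : Program)
  | loop (b : Test) (p : Program)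

def NExp.eval (m : Memory) : NExp → ℕ
  | .const k => k
  | .get A i => m.nat A (i.eval m)
  | .add e₁ e₂ => e₁.eval m + e₂.eval m
  | .sub e₁ e₂ => e₁.eval m - e₂.eval m
  | .mul e₁ e₂ => e₁.eval m * e₂.eval m

noncomputable def RExp.eval (m : Memory) : RExp → ℝ
  | .ofNat e => (e.eval m : ℝ)
  | .get A i => m.real A (i.eval m)
  | .add e₁ e₂ => e₁.eval m + e₂.eval m
  | .sub e₁ e₂ => e₁.eval m - e₂.eval m
  | .mul e₁ e₂ => e₁.eval m * e₂.eval m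
  | .div e₁ e₂ => e₁.eval m / e₂.eval m

def Test.Holds (m : Memory) : Test → Prop
  | .nle e₁ e₂ => e₁.eval m ≤ e₂.eval m
  | .rle e₁ e₂ => e₁.eval m ≤ e₂.eval m
  | .not b => ¬ b.Holds m
  | .and b₁ b₂ => b₁.Holds m ∧ b₂.Holds m

/-- Time for evaluating an expression. -/
def NExp.time : NExp → ℕ
  | .const _ => 1
  | .get _ i => i.time + 1
  | .add e₁ e₂ => e₁.time + e₂.time + 1
  | .sub e₁ e₂ => e₁.time + e₂.time + 1
  | .mul e₁ e₂ => e₁.time + e₂.time + 1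

/-- Time for evaluating an expression. -/
def RExp.time : RExp → ℕ
  | .ofNat e => e.time + 1
  | .get _ i => i.time + 1
  | .add e₁ e₂ => e₁.time + e₂.time + 1
  | .sub e₁ e₂ => e₁.time + e₂.time + 1
  | .mul e₁ e₂ => e₁.time + e₂.time + 1
  | .div e₁ e₂ => e₁.time + e₂.time + 1

/-- Time for evaluating a test. -/
def Test.time : Test → ℕ
  | .nle e₁ e₂ => e₁.time + e₂.time + 1
  | .rle e₁ e₂ => e₁.time + e₂.time + 1
  | .not b => b.time + 1
  | .and b₁ b₂ => b₁.time + b₂.time + 1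

def Memory.setNat (m : Memory) (A i v : ℕ) : Memory :=
  { m with nat := Function.update m.nat A (Function.update (m.nat A) i v) }

noncomputable def Memory.setReal (m : Memory) (A i : ℕ) (v : ℝ) : Memory :=
  { m with real := Function.update m.real A (Function.update (m.real A) i v) }

/-- `Exec p m m' k`: started in the memory `m`, the program `p` halts after exactly `k` time
units with the memory `m'`. -/
inductive Exec : Program → Memory → Memory → ℕ → Prop where
  | skip (m : Memory) : Exec .skip m m 1
  | nset (m : Memory) (A : ℕ) (i e : NExp) :
      Exec (.nset A i e) m (m.setNat A (i.eval m) (e.eval m)) (i.time + e.time + 1)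
  | rset (m : Memory) (A : ℕ) (i : NExp) (e : RExp) :
      Exec (.rset A i e) m (m.setReal A (i.eval m) (e.eval m)) (i.time + e.time + 1)
  | seq {p q : Program} {m m' m'' : Memory} {j k : ℕ} :
      Exec p m m' j → Exec q m' m'' k → Exec (.seq p q) m m'' (j + k)
  | branchTrue {b : Test} {p q : Program} {m m' : Memory} {k : ℕ} :
      b.Holds m → Exec p m m' k → Exec (.branch b p q) m m' (b.time + k)
  | branchFalse {b : Test} {p q : Program} {m m' : Memory} {k : ℕ} :
      ¬ b.Holds m → Exec q m m' k → Exec (.branch b p q) m m' (b.time + k)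
  | loopTrue {b : Test} {p : Program} {m m' m'' : Memory} {j k : ℕ} :
      b.Holds m → Exec p m m' j → Exec (.loop b p) m' m'' k →
      Exec (.loop b p) m m'' (b.time + j + k)
  | loopFalse {b : Test} {p : Program} {m : Memory} :
      ¬ b.Holds m → Exec (.loop b p) m m b.time

/-- Execution is deterministic. -/
theorem Exec.unique {p : Program} {m m₁ m₂ : Memory} {k₁ k₂ : ℕ}
    (h₁ : Exec p m m₁ k₁) (h₂ : Exec p m m₂ k₂) : m₁ = m₂ ∧ k₁ = k₂ := by
  induction h₁ generalizing m₂ k₂ with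
  | skip m => cases h₂; exact ⟨rfl, rfl⟩
  | nset m A i e => cases h₂; exact ⟨rfl, rfl⟩
  | rset m A i e => cases h₂; exact ⟨rfl, rfl⟩
  | seq _ _ ih₁ ih₂ =>
    cases h₂ with
    | seq g₁ g₂ =>
      obtain ⟨rfl, rfl⟩ := ih₁ g₁
      obtain ⟨rfl, rfl⟩ := ih₂ g₂
      exact ⟨rfl, rfl⟩
  | branchTrue hb _ ih =>
    cases h₂ with
    | branchTrue _ g => obtain ⟨rfl, rfl⟩ := ih g; exact ⟨rfl, rfl⟩
    | branchFalse hb' _ => exact absurd hb hb'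
  | branchFalse hb _ ih =>
    cases h₂ with
    | branchTrue hb' _ => exact absurd hb' hb
    | branchFalse _ g => obtain ⟨rfl, rfl⟩ := ih g; exact ⟨rfl, rfl⟩
  | loopTrue hb _ _ ih₁ ih₂ =>
    cases h₂ with
    | loopTrue _ g₁ g₂ =>
      obtain ⟨rfl, rfl⟩ := ih₁ g₁
      obtain ⟨rfl, rfl⟩ := ih₂ g₂
      exact ⟨rfl, rfl⟩
    | loopFalse hb' => exact absurd hb hb'
  | loopFalse hb =>
    cases h₂ with
    | loopTrue hb' _ _ => exact absurd hb' hb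
    | loopFalse _ => exact ⟨rfl, rfl⟩

end RealRAM

/-! ## Input and output of an algorithm for bottleneck routing games -/

namespace BottleneckRoutingGame

/-- The initial memory.  Natural number array `0` holds the numbers of vertices, of arcs and of
players, the source, the sink and the bound `C`; natural number arrays `1` and `2` hold the tails
and the heads of the arcs.  Real array `0` holds, with `n` players, the cost `c_a(k)` in cell
`a * (n + 1) + k`, for every arc `a` and every load `k ≤ n`.  All other cells are `0`. -/
noncomputable def input (G : BottleneckRoutingGame) (C : ℕ) : RealRAM.Memory where
  nat A i :=
    if A = 0 then
      [G.numVertices, G.numArcs, G.numPlayers, (G.s : ℕ), (G.t : ℕ), C].getD i 0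
    else if A = 1 then (if h : i < G.numArcs then (G.src ⟨i, h⟩ : ℕ) else 0)
    else if A = 2 then (if h : i < G.numArcs then (G.tgt ⟨i, h⟩ : ℕ) else 0)
    else 0
  real A i :=
    if A = 0 then
      (if h : i / (G.numPlayers + 1) < G.numArcs then
        G.cost ⟨i / (G.numPlayers + 1), h⟩ ((i % (G.numPlayers + 1) : ℕ) : ℝ)
      else 0)
    else 0

/-- The memory holds the profile `x` as output: cell `i * |A| + a` of natural number array `3` is
`1` if the path of player `i` uses the arc `a`, and `0` otherwise. -/
def IsOutput (G : BottleneckRoutingGame) (m : RealRAM.Memory) (x : G.Profile) : Prop :=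
  ∀ (i : Fin G.numPlayers) (a : Fin G.numArcs),
    m.nat 3 (i * G.numArcs + a) = if a ∈ (x i).1 then 1 else 0

end BottleneckRoutingGame

/-! Call a weight function φ on costs separated if the weight of a larger cost exceeds n|A| times
the weight of any smaller one. Then ∑ φ(c_a(f_a)) f_a compares flows lexicographically: by the total
flow on arcs of the highest cost, then of the next lower cost, and so on
(`Separated.weightedSum_lt`). Let K be the largest private cost in a coalition before an improving
move. The move changes no level above K and strictly lowers level K. So every separated weighted sum
with positive weights on positive costs is a generalized strong ordinal potential
(`Separated.improving`). Moreover, all separated weights order flows in the same way, up to ties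
caused by zero weights (`Separated.weightedSum_le`). The bound on M makes (v/C)^M separated
(`separated_pow`).

The algorithm therefore needs neither M nor δ. It uses the integer weight B^r with B = n|A| + 1,
where r is the number of cost table entries below the given cost. These numbers are long, but
arithmetic has unit cost. They are separated (`separated_factor`), and k units on an arc cost a
convex function of k (`IsWeight.valid`). A minimizer is thus found by successive shortest paths, in
n rounds of Dijkstra's algorithm with vertex potentials; a feasible potential certifies optimality
(`Feasible.optimal`). As arc costs increase strictly with the flow, potentials increase strictly
along arcs carrying flow (`Feasible.lt_of_pos`). Hence the flow is acyclic, and following arcs with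
flow splits it into n simple paths. The resulting profile minimizes the rank-weighted sum, so it is
an SNE, and by the common order it also minimizes the potential for every admissible M.

Every loop makes at most 2·size·(size + 1) iterations, and for a fixed program the running time is
polynomial in this bound (`Program.eval_timePoly`). -/

namespace RealRAM

/-! ### Program logic: frames, running times and loop rules. -/

/-- Names of the natural number arrays that a program may write to. -/
def Program.writes : Program → List ℕ
  | .skip => []
  | .nset A _ _ => [A]
  | .rset _ _ _ => []
  | .seq p q => p.writes ++ q.writes
  | .branch _ p q => p.writes ++ q.writes
  | .loop _ p => p.writes

/-- The program never writes to a real cell. -/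
def Program.keepsReal : Program → Bool
  | .skip => true
  | .nset _ _ _ => true
  | .rset _ _ _ => false
  | .seq p q => p.keepsReal && q.keepsReal
  | .branch _ p q => p.keepsReal && q.keepsReal
  | .loop _ p => p.keepsReal

/-- `m'` agrees with `m` outside of the natural number arrays listed in `L`. -/
def Frame (L : List ℕ) (m m' : Memory) : Prop :=
  m'.real = m.real ∧ ∀ B, B ∉ L → m'.nat B = m.nat B

theorem Frame.refl (L : List ℕ) (m : Memory) : Frame L m m := ⟨rfl, fun _ _ => rfl⟩

theorem Frame.trans {L : List ℕ} {m m' m'' : Memory} (h : Frame L m m') (h' : Frame L m' m'') :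
    Frame L m m'' :=
  ⟨h'.1.trans h.1, fun B hB => (h'.2 B hB).trans (h.2 B hB)⟩

theorem Frame.mono {L L' : List ℕ} {m m' : Memory} (h : Frame L m m') (hL : L ⊆ L') :
    Frame L' m m' :=
  ⟨h.1, fun B hB => h.2 B fun h' => hB (hL h')⟩

theorem Memory.setNat_nat (m : Memory) (A i v B j : ℕ) :
    (m.setNat A i v).nat B j = if B = A then (if j = i then v else m.nat B j) else m.nat B j := by
  unfold Memory.setNat
  by_cases h : B = A
  · subst h
    by_cases h' : j = i
    · simp [h']
    · simp [h']
  · simp [h]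

theorem Memory.setNat_nat_of_ne (m : Memory) {A B : ℕ} (i v : ℕ) (h : B ≠ A) :
    (m.setNat A i v).nat B = m.nat B := by
  simp [Memory.setNat, h]

theorem Memory.setNat_nat_self (m : Memory) (A i v : ℕ) :
    (m.setNat A i v).nat A = Function.update (m.nat A) i v := by
  simp [Memory.setNat]

theorem Exec.frame {p : Program} {m m' : Memory} {k : ℕ} (h : Exec p m m' k)
    (hr : p.keepsReal = true) : Frame p.writes m m' := by
  induction h with
  | skip m => exact Frame.refl _ _
  | nset m A i e =>
    refine ⟨rfl, fun B hB => Memory.setNat_nat_of_ne _ _ _ ?_⟩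
    simpa [Program.writes] using hB
  | rset m A i e => simp [Program.keepsReal] at hr
  | seq _ _ ih₁ ih₂ =>
    simp only [Program.keepsReal, Bool.and_eq_true] at hr
    exact ((ih₁ hr.1).mono (List.subset_append_left _ _)).trans
      ((ih₂ hr.2).mono (List.subset_append_right _ _))
  | branchTrue _ _ ih =>
    simp only [Program.keepsReal, Bool.and_eq_true] at hr
    exact (ih hr.1).mono (List.subset_append_left _ _)
  | branchFalse _ _ ih =>
    simp only [Program.keepsReal, Bool.and_eq_true] at hr
    exact (ih hr.2).mono (List.subset_append_right _ _)
  | loopTrue _ _ _ ih₁ ih₂ => exact (ih₁ hr).trans (ih₂ hr)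
  | loopFalse _ => exact Frame.refl _ _

/-- Bound on the running time of a program all of whose loops make at most `b` iterations. -/
def Program.time (b : ℕ) : Program → ℕ
  | .skip => 1
  | .nset _ i e => i.time + e.time + 1
  | .rset _ i e => i.time + e.time + 1
  | .seq p q => p.time b + q.time b
  | .branch c p q => c.time + (p.time b + q.time b)
  | .loop c p => b * (p.time b + c.time) + c.time

/-- `Program.time` is a polynomial in the bound on the number of iterations. -/
noncomputable def Program.timePoly (b : Polynomial ℕ) : Program → Polynomial ℕ
  | .skip => 1
  | .nset _ i e => .C (i.time + e.time + 1)
  | .rset _ i e => .C (i.time + e.time + 1)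
  | .seq p q => p.timePoly b + q.timePoly b
  | .branch c p q => .C c.time + (p.timePoly b + q.timePoly b)
  | .loop c p => b * (p.timePoly b + .C c.time) + .C c.time

theorem Program.eval_timePoly (b : Polynomial ℕ) (x : ℕ) (p : Program) :
    (p.timePoly b).eval x = p.time (b.eval x) := by
  induction p <;> simp_all [Program.time, Program.timePoly]

/-- Started in `m`, the program `p` halts in a memory satisfying `Q`, after a time that
is consistent with at most `b` iterations of each loop. -/
def Runs (b : ℕ) (p : Program) (m : Memory) (Q : Memory → Prop) : Prop :=
  ∃ m' k, Exec p m m' k ∧ k ≤ p.time b ∧ Q m'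

theorem Runs.mono {b : ℕ} {p : Program} {m : Memory} {Q Q' : Memory → Prop}
    (h : Runs b p m Q) (hQ : ∀ m', Q m' → Q' m') : Runs b p m Q' := by
  obtain ⟨m', k, he, hk, hq⟩ := h
  exact ⟨m', k, he, hk, hQ m' hq⟩

theorem Runs.frame {b : ℕ} {p : Program} {m : Memory} {Q : Memory → Prop}
    (h : Runs b p m Q) {L : List ℕ} (hr : p.keepsReal = true) (hL : p.writes ⊆ L) :
    Runs b p m fun m' => Q m' ∧ Frame L m m' := by
  obtain ⟨m', k, he, hk, hq⟩ := h
  exact ⟨m', k, he, hk, hq, (he.frame hr).mono hL⟩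

theorem Runs.seq {b : ℕ} {p q : Program} {m : Memory} {Q : Memory → Prop}
    (h : Runs b p m fun m' => Runs b q m' Q) : Runs b (.seq p q) m Q := by
  obtain ⟨m', k, he, hk, m'', k', he', hk', hq⟩ := h
  exact ⟨m'', k + k', .seq he he', add_le_add hk hk', hq⟩

/-- The measure `μ` drops in every iteration, so its initial value bounds the number of iterations.
-/
theorem Runs.loop {b : ℕ} {c : Test} {p : Program} (I : Memory → Prop) (μ : Memory → ℕ)
    (hstep : ∀ m, I m → c.Holds m → Runs b p m fun m' => I m' ∧ μ m' < μ m) {m : Memory}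
    (hm : I m) (hb : μ m ≤ b) : Runs b (.loop c p) m fun m' => I m' ∧ ¬ c.Holds m' := by
  -- The induction needs the bound with `μ m` iterations; it is relaxed to `b` only at the end.
  suffices h : ∃ m' k, Exec (.loop c p) m m' k ∧ k ≤ μ m * (p.time b + c.time) + c.time ∧
      I m' ∧ ¬ c.Holds m' by
    obtain ⟨m', k, he, hk, hq⟩ := h
    exact ⟨m', k, he, hk.trans (Nat.add_le_add_right (Nat.mul_le_mul_right _ hb) _), hq⟩
  clear hb
  induction hn : μ m using Nat.strong_induction_on generalizing m with
  | _ N ih =>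
    subst hn
    by_cases hc : c.Holds m
    · obtain ⟨m₁, k₁, he₁, hk₁, hI, hμ⟩ := hstep m hm hc
      obtain ⟨m₂, k₂, he₂, hk₂, hq⟩ := ih _ hμ hI rfl
      refine ⟨m₂, _, .loopTrue hc he₁ he₂, ?_, hq⟩
      have := Nat.mul_le_mul_right (p.time b + c.time) (Nat.succ_le_of_lt hμ)
      rw [Nat.succ_mul] at this
      omega
    · exact ⟨m, _, .loopFalse hc, Nat.le_add_left _ _, hm, hc⟩

/-- The effect of a program without loops. -/
noncomputable def Program.run : Program → Memory → Memory
  | .skip, m => m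
  | .nset A i e, m => m.setNat A (i.eval m) (e.eval m)
  | .rset A i e, m => m.setReal A (i.eval m) (e.eval m)
  | .seq p q, m => q.run (p.run m)
  | .branch b p q, m => open Classical in if b.Holds m then p.run m else q.run m
  | .loop _ _, m => m

def Program.loopFree : Program → Bool
  | .skip => true
  | .nset _ _ _ => true
  | .rset _ _ _ => true
  | .seq p q => p.loopFree && q.loopFree
  | .branch _ p q => p.loopFree && q.loopFree
  | .loop _ _ => false

/-- Reduces straight-line code to the computation of `Program.run`. -/
theorem Runs.of_loopFree {b : ℕ} {p : Program} (hp : p.loopFree = true) {m : Memory}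
    {Q : Memory → Prop} (h : Q (p.run m)) : Runs b p m Q := by
  suffices h' : ∀ m, ∃ k, Exec p m (p.run m) k ∧ k ≤ p.time b by
    obtain ⟨k, he, hk⟩ := h' m
    exact ⟨_, k, he, hk, h⟩
  clear h m
  induction p with
  | skip => exact fun m => ⟨1, .skip m, le_rfl⟩
  | nset A i e => exact fun m => ⟨_, .nset m A i e, le_rfl⟩
  | rset A i e => exact fun m => ⟨_, .rset m A i e, le_rfl⟩
  | seq p q ihp ihq =>
    simp only [Program.loopFree, Bool.and_eq_true] at hp
    intro m
    obtain ⟨k, he, hk⟩ := ihp hp.1 m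
    obtain ⟨k', he', hk'⟩ := ihq hp.2 (p.run m)
    exact ⟨k + k', .seq he he', add_le_add hk hk'⟩
  | branch c p q ihp ihq =>
    simp only [Program.loopFree, Bool.and_eq_true] at hp
    intro m
    obtain ⟨k, he, hk⟩ := ihp hp.1 m
    obtain ⟨k', he', hk'⟩ := ihq hp.2 m
    by_cases hc : c.Holds m
    · refine ⟨c.time + k, ?_, by simp only [Program.time]; omega⟩
      simpa [Program.run, hc] using Exec.branchTrue (q := q) hc he
    · refine ⟨c.time + k', ?_, by simp only [Program.time]; omega⟩
      simpa [Program.run, hc] using Exec.branchFalse (p := p) hc he'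
  | loop c p => simp [Program.loopFree] at hp

/-- `for X in [0, bound) do p`, with the counter in cell `0` of array `X`. -/
def Program.forLoop (X : ℕ) (bound : NExp) (p : Program) : Program :=
  .seq (.nset X (.const 0) (.const 0))
    (.loop (.not (.nle bound (.get X (.const 0))))
      (.seq p (.nset X (.const 0) (.add (.get X (.const 0)) (.const 1)))))

/-- The bound is evaluated anew before each iteration; `hN` keeps it constant on all memories that
the loop can reach. The invariant refers to the memory after the counter has been incremented. -/
theorem Runs.forLoop {b X : ℕ} {bound : NExp} {p : Program} {m : Memory} (L : List ℕ)
    (N : ℕ) (I : ℕ → Memory → Prop) (hr : p.keepsReal = true) (hL : p.writes ⊆ L)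
    (hXp : X ∉ p.writes) (hX : X ∈ L) (hNb : N ≤ b)
    (hN : ∀ m', Frame L m m' → bound.eval m' = N)
    (h0 : I 0 (m.setNat X 0 0))
    (hstep : ∀ i < N, ∀ m', Frame L m m' → m'.nat X 0 = i → I i m' →
      Runs b p m' fun m'' => I (i + 1) (m''.setNat X 0 (i + 1))) :
    Runs b (.forLoop X bound p) m fun m' => I N m' ∧ Frame L m m' := by
  have hset : ∀ m' v, Frame L m' (m'.setNat X 0 v) := fun m' v =>
    ⟨rfl, fun B hB => Memory.setNat_nat_of_ne _ _ _ fun h => hB (h ▸ hX)⟩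
  have main := Runs.loop (b := b) (c := .not (.nle bound (.get X (.const 0))))
    (p := .seq p (.nset X (.const 0) (.add (.get X (.const 0)) (.const 1))))
    (fun m' => Frame L m m' ∧ m'.nat X 0 ≤ N ∧ I (m'.nat X 0) m') (fun m' => N - m'.nat X 0)
    (fun m' ⟨hF, hle, hI⟩ hb => by
      have hlt : m'.nat X 0 < N := by
        simpa [Test.Holds, NExp.eval, hN m' hF] using hb
      apply Runs.seq
      refine ((hstep _ hlt m' hF rfl hI).frame hr (List.Subset.refl p.writes)).mono ?_
      rintro m'' ⟨hI', hF'⟩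
      refine Runs.of_loopFree rfl ?_
      have hXX : m''.nat X = m'.nat X := hF'.2 X hXp
      simp only [Program.run, NExp.eval, hXX]
      refine ⟨⟨(hF.trans (hF'.mono hL)).trans (hset _ _), ?_, ?_⟩, ?_⟩
      · simp [Memory.setNat_nat]; omega
      · simpa [Memory.setNat_nat] using hI'
      · simp [Memory.setNat_nat]; omega)
    (m := m.setNat X 0 0) ⟨hset _ _, by simp [Memory.setNat_nat],
      by simpa [Memory.setNat_nat] using h0⟩ (by simpa [Memory.setNat_nat] using hNb)
  refine (Runs.seq (Runs.of_loopFree rfl main)).mono ?_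
  rintro m' ⟨⟨hF, hle, hI⟩, hb⟩
  have : m'.nat X 0 = N := by
    have : N ≤ m'.nat X 0 := by simpa [Test.Holds, NExp.eval, hN m' hF] using hb
    omega
  exact ⟨this ▸ hI, hF⟩

end RealRAM

/-! ### Minimum cost flows: residual arcs, potentials and optimality. -/

/-- A network with arcs `0, …, A - 1` on the vertices `0, …, V - 1`, in which sending `k ≤ n` units
through the arc `a` costs `k * E (a * (n + 1) + k)`. -/
structure Net where
  V : ℕ
  A : ℕ
  n : ℕ
  s : ℕ
  t : ℕ
  src : ℕ → ℕ
  tgt : ℕ → ℕ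
  E : ℕ → ℕ

namespace Net

/-- Cost of `k` units on the arc `a`. -/
def w (N : Net) (a k : ℕ) : ℕ := k * N.E (a * (N.n + 1) + k)

/-- The assumptions on the network. -/
structure Valid (N : Net) : Prop where
  s_lt : N.s < N.V
  t_lt : N.t < N.V
  s_ne_t : N.s ≠ N.t
  src_lt : ∀ a < N.A, N.src a < N.V
  tgt_lt : ∀ a < N.A, N.tgt a < N.V
  reach : ∀ R : ℕ → Prop, R N.s → (∀ a < N.A, R (N.src a) → R (N.tgt a)) → R N.t
  w_lt : ∀ a < N.A, ∀ k < N.n, N.w a k < N.w a (k + 1)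
  w_convex : ∀ a < N.A, ∀ k, k + 2 ≤ N.n → 2 * N.w a (k + 1) ≤ N.w a k + N.w a (k + 2)

/-- Net outflow of the vertex `v`. -/
def div (N : Net) (f : ℕ → ℕ) (v : ℕ) : ℤ :=
  ∑ a ∈ Finset.range N.A, (f a : ℤ) *
    ((if N.src a = v then 1 else 0) - (if N.tgt a = v then 1 else 0))

def IsFlow (N : Net) (f : ℕ → ℕ) (k : ℕ) : Prop :=
  ∀ v, N.div f v = k * ((if N.s = v then 1 else 0) - (if N.t = v then 1 else 0))

/-! The residual network: the residual arc `e < A` increases the flow on the arc `e`, the residual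
arc `A + a` decreases the flow on the arc `a`. -/

/-- Truncated subtraction makes this `0` for `e < A` and `1` otherwise, so that the machine can
compute it without branching. -/
def dir (N : Net) (e : ℕ) : ℕ := 1 - (N.A - e)

def arc (N : Net) (e : ℕ) : ℕ := e - N.A * N.dir e

def tail (N : Net) (e : ℕ) : ℕ :=
  N.src (N.arc e) * (1 - N.dir e) + N.tgt (N.arc e) * N.dir e

def head (N : Net) (e : ℕ) : ℕ :=
  N.src (N.arc e) * N.dir e + N.tgt (N.arc e) * (1 - N.dir e)

/-- Flow on the underlying arc after sending one unit along the residual arc `e`. -/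
def next (N : Net) (f : ℕ → ℕ) (e : ℕ) : ℕ := f (N.arc e) + 1 - 2 * N.dir e

def Residual (N : Net) (f : ℕ → ℕ) (e : ℕ) : Prop :=
  N.dir e ≤ f (N.arc e) ∧ N.next f e ≤ N.n

/-- Non-negativity of the reduced costs. Terms are moved across the inequality because backward
residual arcs change the cost by a negative amount, while all quantities are natural numbers. -/
def Feasible (N : Net) (f π : ℕ → ℕ) : Prop :=
  ∀ e < 2 * N.A, N.Residual f e →
    N.w (N.arc e) (f (N.arc e)) + π (N.head e) ≤ N.w (N.arc e) (N.next f e) + π (N.tail e)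

def Tight (N : Net) (f π : ℕ → ℕ) (e : ℕ) : Prop :=
  N.Residual f e ∧
    N.w (N.arc e) (f (N.arc e)) + π (N.head e) = N.w (N.arc e) (N.next f e) + π (N.tail e)

theorem dir_eq_zero {N : Net} {e : ℕ} (h : e < N.A) : N.dir e = 0 := by
  unfold dir; omega

theorem dir_eq_one {N : Net} {e : ℕ} (h : N.A ≤ e) : N.dir e = 1 := by
  unfold dir; omega

theorem arc_of_lt {N : Net} {e : ℕ} (h : e < N.A) : N.arc e = e := by
  simp [arc, dir_eq_zero h]

theorem arc_of_le {N : Net} {e : ℕ} (h : N.A ≤ e) : N.arc e = e - N.A := by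
  simp [arc, dir_eq_one h]

theorem arc_lt {N : Net} {e : ℕ} (h : e < 2 * N.A) : N.arc e < N.A := by
  rcases lt_or_ge e N.A with h' | h'
  · rwa [arc_of_lt h']
  · rw [arc_of_le h']; omega

theorem dir_cases (N : Net) (e : ℕ) :
    (N.dir e = 0 ∧ N.tail e = N.src (N.arc e) ∧ N.head e = N.tgt (N.arc e)) ∨
    (N.dir e = 1 ∧ N.tail e = N.tgt (N.arc e) ∧ N.head e = N.src (N.arc e)) := by
  rcases lt_or_ge e N.A with h | h
  · left; simp [tail, head, dir_eq_zero h]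
  · right; simp [tail, head, dir_eq_one h]

theorem Valid.tail_lt {N : Net} (hN : N.Valid) {e : ℕ} (h : e < 2 * N.A) : N.tail e < N.V := by
  rcases N.dir_cases e with ⟨-, h1, -⟩ | ⟨-, h1, -⟩ <;> rw [h1]
  · exact hN.src_lt _ (arc_lt h)
  · exact hN.tgt_lt _ (arc_lt h)

theorem Valid.head_lt {N : Net} (hN : N.Valid) {e : ℕ} (h : e < 2 * N.A) : N.head e < N.V := by
  rcases N.dir_cases e with ⟨-, -, h1⟩ | ⟨-, -, h1⟩ <;> rw [h1]
  · exact hN.tgt_lt _ (arc_lt h)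
  · exact hN.src_lt _ (arc_lt h)

/-- Feasibility in terms of arcs instead of residual arcs. -/
theorem feasible_iff {N : Net} {f π : ℕ → ℕ} : N.Feasible f π ↔ ∀ a < N.A,
    (f a + 1 ≤ N.n → N.w a (f a) + π (N.tgt a) ≤ N.w a (f a + 1) + π (N.src a)) ∧
    (1 ≤ f a → f a ≤ N.n + 1 → N.w a (f a) + π (N.src a) ≤ N.w a (f a - 1) + π (N.tgt a)) := by
  constructor
  · intro h a ha
    constructor
    · intro hn
      have h0 := dir_eq_zero ha
      have h1 := arc_of_lt ha
      have := h a (by omega)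
      simpa [Residual, next, tail, head, h0, h1, hn] using this
    · intro h1 hn
      have h2 : N.arc (N.A + a) = a := by rw [arc_of_le (by omega)]; omega
      have h3 : N.dir (N.A + a) = 1 := dir_eq_one (by omega)
      have := h (N.A + a) (by omega)
      simpa [Residual, next, tail, head, h2, h3, h1, hn] using this
  · intro h e he hr
    obtain ⟨h1, h2⟩ := h _ (arc_lt he)
    rcases N.dir_cases e with ⟨hd, ht, hh⟩ | ⟨hd, ht, hh⟩
    · simp only [Residual, next, hd, ht, hh] at hr ⊢
      exact h1 (by omega)
    · simp only [Residual, next, hd, ht, hh] at hr ⊢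
      have := h2 (by omega) (by omega)
      simpa using this

/-- Sending a unit along a tight residual arc preserves feasibility. -/
theorem Feasible.push {N : Net} (hN : N.Valid) {f π : ℕ → ℕ} (hf : N.Feasible f π) {e : ℕ}
    (hfn : f (N.arc e) ≤ N.n) (ht : N.Tight f π e) :
    N.Feasible (Function.update f (N.arc e) (N.next f e)) π := by
  rw [feasible_iff] at hf ⊢
  intro a ha
  by_cases hae : a = N.arc e
  · obtain ⟨⟨hr1, hr2⟩, ht⟩ := ht
    obtain ⟨h1, h2⟩ := hf a ha
    subst hae
    -- Only the constraints of this arc change. Tightness gives the one for undoing the push with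
    -- equality; convexity gives the one for pushing further in the same direction.
    have hc := hN.w_convex _ ha
    rcases N.dir_cases e with ⟨hd, htl, hhd⟩ | ⟨hd, htl, hhd⟩
    · simp only [next, hd, htl, hhd, Function.update_self, mul_zero, Nat.sub_zero] at hr2 ht ⊢
      refine ⟨fun h => ?_, fun _ _ => ?_⟩
      · have := hc (f (N.arc e)) h
        rw [show f (N.arc e) + 1 + 1 = f (N.arc e) + 2 from rfl]
        omega
      · rw [Nat.add_sub_cancel]; omega
    · simp only [next, hd, htl, hhd, Function.update_self, mul_one] at hr1 hr2 ht ⊢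
      generalize f (N.arc e) = F at *
      obtain ⟨j, rfl⟩ := Nat.exists_eq_add_of_le' hr1
      rw [show j + 1 + 1 - 2 = j by omega] at *
      refine ⟨fun h => by omega, fun h _ => ?_⟩
      obtain ⟨i, rfl⟩ := Nat.exists_eq_add_of_le' h
      have := hc i hfn
      rw [Nat.add_sub_cancel] at *
      rw [show i + 1 + 1 = i + 2 from rfl] at *
      omega
  · simpa [Function.update_of_ne hae] using hf a ha

theorem div_update {N : Net} (f : ℕ → ℕ) {a : ℕ} (ha : a < N.A) (g v : ℕ) :
    N.div (Function.update f a g) v = N.div f v + ((g : ℤ) - f a) *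
      ((if N.src a = v then 1 else 0) - (if N.tgt a = v then 1 else 0)) := by
  unfold div
  rw [← Finset.add_sum_erase _ _ (Finset.mem_range.2 ha),
    ← Finset.add_sum_erase (Finset.range N.A) (fun a => (f a : ℤ) * _) (Finset.mem_range.2 ha)]
  rw [Function.update_self]
  have : ∀ b ∈ (Finset.range N.A).erase a, Function.update f a g b = f b := fun b hb =>
    Function.update_of_ne (Finset.ne_of_mem_erase hb) _ _
  rw [Finset.sum_congr rfl fun b hb => by rw [this b hb]]
  ring

theorem div_push {N : Net} {f : ℕ → ℕ} {e : ℕ} (he : e < 2 * N.A) (hr : N.dir e ≤ f (N.arc e))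
    (v : ℕ) : N.div (Function.update f (N.arc e) (N.next f e)) v =
      N.div f v + ((if N.tail e = v then 1 else 0) - (if N.head e = v then 1 else 0)) := by
  rw [div_update f (arc_lt he)]
  rcases N.dir_cases e with ⟨hd, htl, hhd⟩ | ⟨hd, htl, hhd⟩
  · rw [htl, hhd, next, hd]; push_cast; ring
  · rw [htl, hhd, next, hd]
    rw [hd] at hr
    rw [show f (N.arc e) + 1 - 2 * 1 = f (N.arc e) - 1 by omega]
    push_cast [hr]
    ring

/-- Summation by parts. The left-hand side depends only on the divergence, hence is the same for all
flows of equal value. -/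
theorem sum_mul_div {N : Net} (hN : N.Valid) (f π : ℕ → ℕ) :
    ∑ v ∈ Finset.range N.V, (π v : ℤ) * N.div f v =
      ∑ a ∈ Finset.range N.A, (f a : ℤ) * (π (N.src a) - π (N.tgt a)) := by
  unfold div
  simp_rw [Finset.mul_sum]
  rw [Finset.sum_comm]
  refine Finset.sum_congr rfl fun a ha => ?_
  have h1 := Finset.mem_range.2 (hN.src_lt a (Finset.mem_range.1 ha))
  have h2 := Finset.mem_range.2 (hN.tgt_lt a (Finset.mem_range.1 ha))
  simp only [mul_sub, Finset.sum_sub_distrib, mul_ite, mul_one, mul_zero, Finset.sum_ite_eq, h1, h2,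
    if_true]
  ring

/-- A feasible potential gives a linear lower bound for the arc costs. -/
theorem Feasible.le_w {N : Net} (hN : N.Valid) {f π : ℕ → ℕ} (hf : N.Feasible f π) {a g : ℕ}
    (ha : a < N.A) (hfn : f a ≤ N.n) (hg : g ≤ N.n) :
    (N.w a (f a) : ℤ) + ((g : ℤ) - f a) * ((π (N.tgt a) : ℤ) - π (N.src a)) ≤ N.w a g := by
  obtain ⟨h1, h2⟩ := feasible_iff.1 hf a ha
  have hc := hN.w_convex a ha
  rcases le_total (f a) g with h | h
  · obtain ⟨d, rfl⟩ := Nat.exists_eq_add_of_le h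
    -- By convexity, all marginal costs above `f a` are at least the first one, hence at least the
    -- potential difference.
    have key : ∀ d, f a + d + 1 ≤ N.n → (N.w a (f a + d) : ℤ) + ((π (N.tgt a) : ℤ) - π (N.src a))
        ≤ N.w a (f a + d + 1) := by
      intro d
      induction d with
      | zero => intro h; have := h1 h; simp only [add_zero]; omega
      | succ d ih =>
        intro h
        have i1 := ih (by omega)
        have i2 := hc (f a + d) (by omega)
        rw [show f a + (d + 1) + 1 = f a + d + 2 by ring, show f a + (d + 1) = f a + d + 1 by ring]
        omega
    clear h
    induction d with
    | zero => simp
    | succ d ih =>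
      have i1 := ih (by omega)
      have i2 := key d (by omega)
      rw [show f a + (d + 1) = f a + d + 1 by ring]
      push_cast at i1 ⊢
      linarith
  · obtain ⟨d, hd⟩ := Nat.exists_eq_add_of_le h
    -- Symmetrically, all marginal costs below `f a` are at most the last one, hence at most the
    -- potential difference.
    have key : ∀ d j, f a = j + d + 1 → (N.w a (j + 1) : ℤ) ≤
        N.w a j + ((π (N.tgt a) : ℤ) - π (N.src a)) := by
      intro d
      induction d with
      | zero =>
        intro j h
        have := h2 (by omega) (by omega)
        rw [h] at this
        simp only [add_zero, Nat.add_sub_cancel] at this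
        omega
      | succ d ih =>
        intro j h
        have i1 := ih (j + 1) (by omega)
        have i2 := hc j (by omega)
        rw [show j + 1 + 1 = j + 2 by ring] at i1
        omega
    have key2 : ∀ d' ≤ d, (N.w a (g + d') : ℤ) ≤
        N.w a g + d' * ((π (N.tgt a) : ℤ) - π (N.src a)) := by
      intro d'
      induction d' with
      | zero => intro _; simp
      | succ d' ih =>
        intro h'
        have i1 := ih (by omega)
        have i2 := key (d - d' - 1) (g + d') (by omega)
        rw [show g + (d' + 1) = g + d' + 1 by ring]
        push_cast
        linarith
    have := key2 d le_rfl
    rw [← hd] at this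
    rw [hd] at *
    push_cast
    linarith

/-- A flow with a feasible potential has minimal cost. -/
theorem Feasible.optimal {N : Net} (hN : N.Valid) {f g π : ℕ → ℕ} (hf : N.Feasible f π) {k : ℕ}
    (hfk : N.IsFlow f k) (hgk : N.IsFlow g k) (hfn : ∀ a < N.A, f a ≤ N.n)
    (hgn : ∀ a < N.A, g a ≤ N.n) :
    ∑ a ∈ Finset.range N.A, N.w a (f a) ≤ ∑ a ∈ Finset.range N.A, N.w a (g a) := by
  have h1 := sum_mul_div hN f π
  have h2 := sum_mul_div hN g π
  have h3 : ∑ v ∈ Finset.range N.V, (π v : ℤ) * N.div f v =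
      ∑ v ∈ Finset.range N.V, (π v : ℤ) * N.div g v :=
    Finset.sum_congr rfl fun v _ => by rw [hfk v, hgk v]
  have h4 := Finset.sum_le_sum fun a (ha : a ∈ Finset.range N.A) =>
    hf.le_w hN (Finset.mem_range.1 ha) (hfn a (Finset.mem_range.1 ha))
      (hgn a (Finset.mem_range.1 ha))
  rw [Finset.sum_add_distrib] at h4
  -- The linear terms of the lower bounds cancel because both flows have the same divergence.
  have h5 : ∑ a ∈ Finset.range N.A, ((g a : ℤ) - f a) * ((π (N.tgt a) : ℤ) - π (N.src a)) = 0 := by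
    rw [← sub_eq_zero.2 (h1.symm.trans (h3.trans h2)), ← Finset.sum_sub_distrib]
    exact Finset.sum_congr rfl fun a _ => by ring
  rw [h5, add_zero] at h4
  exact_mod_cast h4

/-- Potentials increase strictly along arcs carrying flow. -/
theorem Feasible.lt_of_pos {N : Net} (hN : N.Valid) {f π : ℕ → ℕ} (hf : N.Feasible f π) {a : ℕ}
    (ha : a < N.A) (hfn : f a ≤ N.n) (hpos : 0 < f a) : π (N.src a) < π (N.tgt a) := by
  -- Withdrawing a unit is possible and strictly lowers the cost, so feasibility of the backward arc
  -- forces the potential to rise along `a`.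
  have h1 := (feasible_iff.1 hf a ha).2 hpos (by omega)
  have h2 := hN.w_lt a ha (f a - 1) (by omega)
  rw [Nat.sub_add_cancel hpos] at h2
  omega

theorem exists_out {N : Net} {f : ℕ → ℕ} {v : ℕ} (h : 0 < N.div f v) :
    ∃ a < N.A, N.src a = v ∧ 0 < f a := by
  by_contra! hcon
  refine absurd h (not_lt.2 (Finset.sum_nonpos fun a ha => ?_))
  have := hcon a (Finset.mem_range.1 ha)
  by_cases hs : N.src a = v
  · have h0 : f a = 0 := by have := this hs; omega
    simp [h0]
  · simp only [hs, if_false, zero_sub, mul_neg, neg_nonpos]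
    positivity

/-! ### Shortest path trees and augmentation. -/

/-- Residual arcs that leave the set of marked vertices. -/
def Adm (N : Net) (f mark : ℕ → ℕ) (e : ℕ) : Prop :=
  mark (N.tail e) ≠ 0 ∧ mark (N.head e) = 0 ∧ N.dir e ≤ f (N.arc e)

/-- Reduced cost of a residual arc. -/
def slack (N : Net) (f π : ℕ → ℕ) (e : ℕ) : ℕ :=
  (N.w (N.arc e) (N.next f e) + π (N.tail e)) - (N.w (N.arc e) (f (N.arc e)) + π (N.head e))

/-- Forward residual arcs always meet the flow condition of `Adm`. If none left the marked set, that
set would be closed under arcs and contain the sink. -/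
theorem Valid.exists_adm {N : Net} (hN : N.Valid) {f mark : ℕ → ℕ} (hs : mark N.s ≠ 0)
    (ht : mark N.t = 0) : ∃ e < 2 * N.A, N.Adm f mark e := by
  by_contra! hcon
  refine hN.reach (fun v => mark v ≠ 0) hs (fun a ha h h0 => ?_) ht
  have hd := dir_eq_zero ha
  have h1 := arc_of_lt ha
  exact hcon a (by omega) ⟨by simpa [tail, hd, h1] using h, by simpa [head, hd, h1] using h0,
    by simp [hd]⟩

/-- Number of unmarked vertices. -/
def unmarked (N : Net) (mark : ℕ → ℕ) : ℕ := ((Finset.range N.V).filter fun v => mark v = 0).card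

/-- The marked vertices form a tree of tight residual arcs rooted in the source; `mark v` is the
position of `v` in the order in which the vertices were reached. -/
structure Tree (N : Net) (f π mark par : ℕ → ℕ) (cnt : ℕ) : Prop where
  feasible : N.Feasible f π
  source : mark N.s ≠ 0
  lt_cnt : ∀ v < N.V, mark v < cnt
  count : N.unmarked mark + cnt = N.V + 1
  par_lt : ∀ v < N.V, v ≠ N.s → mark v ≠ 0 → par v < 2 * N.A
  head_par : ∀ v < N.V, v ≠ N.s → mark v ≠ 0 → N.head (par v) = v
  mark_tail : ∀ v < N.V, v ≠ N.s → mark v ≠ 0 → mark (N.tail (par v)) ≠ 0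
  mark_lt : ∀ v < N.V, v ≠ N.s → mark v ≠ 0 → mark (N.tail (par v)) < mark v
  tight : ∀ v < N.V, v ≠ N.s → mark v ≠ 0 → N.Tight f π (par v)

theorem unmarked_update {N : Net} {mark : ℕ → ℕ} {v c : ℕ} (hv : v < N.V) (h0 : mark v = 0)
    (hc : c ≠ 0) : N.unmarked (Function.update mark v c) + 1 = N.unmarked mark := by
  unfold unmarked
  have : ((Finset.range N.V).filter fun u => Function.update mark v c u = 0) =
      ((Finset.range N.V).filter fun u => mark u = 0).erase v := by
    ext u
    by_cases h : u = v
    · subst h; simp [hc]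
    · simp [h]
  rw [this]
  exact Finset.card_erase_add_one (by simp [hv, h0])

/-- One step of Dijkstra's algorithm. -/
theorem Tree.step {N : Net} (hN : N.Valid) {f π π' mark par : ℕ → ℕ} {cnt e : ℕ}
    (hT : N.Tree f π mark par cnt) (hfn : ∀ a < N.A, f a < N.n) (he : e < 2 * N.A)
    (hadm : N.Adm f mark e)
    (hmin : ∀ e' < 2 * N.A, N.Adm f mark e' → N.slack f π e ≤ N.slack f π e')
    (hπ : ∀ v < N.V, π' v = if mark v = 0 then π v + N.slack f π e else π v) :
    N.Tree f π' (Function.update mark (N.head e) cnt) (Function.update par (N.head e) e)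
      (cnt + 1) := by
  -- Each arc carries less than `n` units, so the capacity never binds and `Adm` need not test it.
  have hnext : ∀ e' < 2 * N.A, N.next f e' ≤ N.n := fun e' he' => by
    have := hfn _ (arc_lt he')
    unfold next; omega
  have hhd := hN.head_lt he
  have htl := hN.tail_lt he
  have hcnt : cnt ≠ 0 := by have := hT.lt_cnt _ hhd; omega
  obtain ⟨ha1, ha2, ha3⟩ := hadm
  have hsne : N.head e ≠ N.s := fun h => hT.source (h ▸ ha2)
  have htne : N.tail e ≠ N.head e := fun h => ha1 (h ▸ ha2)
  have hmark : ∀ v, v ≠ N.head e → Function.update mark (N.head e) cnt v = mark v := fun v hv =>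
    Function.update_of_ne hv _ _
  have hpar : ∀ v, v ≠ N.head e → Function.update par (N.head e) e v = par v := fun v hv =>
    Function.update_of_ne hv _ _
  have hadd : N.w (N.arc e) (f (N.arc e)) + π (N.head e) + N.slack f π e =
      N.w (N.arc e) (N.next f e) + π (N.tail e) := by
    have := hT.feasible e he ⟨ha3, hnext e he⟩
    unfold slack; omega
  have htail : ∀ v < N.V, v ≠ N.s → mark v ≠ 0 → N.tail (par v) ≠ N.head e := fun v hv hvs hm h =>
    hT.mark_tail v hv hvs hm (h ▸ ha2)
  constructor
  · intro e' he' hr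
    have h1 := hT.feasible e' he' hr
    rw [hπ _ (hN.head_lt he'), hπ _ (hN.tail_lt he')]
    -- Slack is lost only on arcs from marked to unmarked vertices, and by an amount that is the
    -- minimum over these arcs.
    by_cases hm1 : mark (N.head e') = 0 <;> by_cases hm2 : mark (N.tail e') = 0 <;>
      simp only [hm1, hm2, if_true, if_false]
    · omega
    · have := hmin e' he' ⟨hm2, hm1, hr.1⟩
      have h2 : N.slack f π e' = (N.w (N.arc e') (N.next f e') + π (N.tail e')) -
        (N.w (N.arc e') (f (N.arc e')) + π (N.head e')) := rfl
      omega
    · omega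
    · omega
  · rw [hmark _ hsne.symm]; exact hT.source
  · intro v hv
    by_cases h : v = N.head e
    · subst h; simp
    · rw [hmark _ h]; have := hT.lt_cnt v hv; omega
  · have := unmarked_update hhd ha2 hcnt
    have := hT.count
    omega
  all_goals
    intro v hv hvs hm
    by_cases h : v = N.head e
    · subst h
      simp only [Function.update_self, hmark _ htne] <;> first
      | exact he
      | exact ha1
      | exact hT.lt_cnt _ htl
      | exact ⟨⟨ha3, hnext e he⟩, by
          rw [hπ _ hhd, hπ _ htl, if_pos ha2, if_neg ha1]; omega⟩
    · rw [hmark _ h] at hm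
      simp only [hmark _ h, hpar _ h, hmark _ (htail v hv hvs hm)]
      first
      | exact hT.par_lt v hv hvs hm
      | exact hT.head_par v hv hvs hm
      | exact hT.mark_tail v hv hvs hm
      | exact hT.mark_lt v hv hvs hm
      | exact ⟨(hT.tight v hv hvs hm).1, by
          have h1 := hT.head_par v hv hvs hm
          have h2 := hT.mark_tail v hv hvs hm
          rw [hπ _ (hN.tail_lt (hT.par_lt v hv hvs hm)), if_neg h2, h1, hπ _ hv, if_neg hm]
          have := (hT.tight v hv hvs hm).2
          rwa [h1] at this⟩

/-- Initially, only the source is reached. -/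
theorem tree_init {N : Net} (hN : N.Valid) {f π mark par : ℕ → ℕ} (hf : N.Feasible f π)
    (hm : ∀ v < N.V, mark v = if v = N.s then 1 else 0) : N.Tree f π mark par 2 := by
  have hm' : ∀ v < N.V, v ≠ N.s → mark v ≠ 0 → False := fun v hv hvs h => by
    rw [hm v hv, if_neg hvs] at h; exact h rfl
  refine ⟨hf, ?_, ?_, ?_, fun v hv hvs h => (hm' v hv hvs h).elim,
    fun v hv hvs h => (hm' v hv hvs h).elim, fun v hv hvs h => (hm' v hv hvs h).elim,
    fun v hv hvs h => (hm' v hv hvs h).elim, fun v hv hvs h => (hm' v hv hvs h).elim⟩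
  · simp [hm _ hN.s_lt]
  · intro v hv; rw [hm v hv]; split_ifs <;> omega
  · unfold unmarked
    have : ((Finset.range N.V).filter fun v => mark v = 0) = (Finset.range N.V).erase N.s := by
      ext v
      simp only [Finset.mem_filter, Finset.mem_range, Finset.mem_erase]
      constructor
      · rintro ⟨h1, h2⟩
        refine ⟨fun h => ?_, h1⟩
        rw [hm v h1, if_pos h] at h2; omega
      · rintro ⟨h1, h2⟩
        exact ⟨h2, by rw [hm v h2, if_neg h1]⟩
    rw [this, Finset.card_erase_of_mem (Finset.mem_range.2 hN.s_lt), Finset.card_range]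
    have := hN.s_lt
    omega

/-- State of the augmentation along the tree path from the source to the sink, which is traversed
backwards and has been processed up to the vertex `cur`; `f` is the original flow, of value `k`. -/
structure Aug (N : Net) (f π mark par : ℕ → ℕ) (k : ℕ) (f' : ℕ → ℕ) (cur : ℕ) : Prop where
  cur_lt : cur < N.V
  marked : mark cur ≠ 0
  feasible : N.Feasible f' π
  le : ∀ a < N.A, f' a ≤ k + 1
  same : ∀ v < N.V, v ≠ N.s → mark v ≠ 0 → mark v ≤ mark cur →
    f' (N.arc (par v)) = f (N.arc (par v))
  div_eq : ∀ v, N.div f' v = k * ((if N.s = v then 1 else 0) - (if N.t = v then 1 else 0)) +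
    ((if cur = v then 1 else 0) - (if N.t = v then 1 else 0))

theorem Aug.init {N : Net} (hN : N.Valid) {f π mark par : ℕ → ℕ} {k cnt : ℕ}
    (hT : N.Tree f π mark par cnt) (ht : mark N.t ≠ 0) (hfk : ∀ a < N.A, f a ≤ k)
    (hflow : N.IsFlow f k) : N.Aug f π mark par k f N.t :=
  ⟨hN.t_lt, ht, hT.feasible, fun a ha => (hfk a ha).trans (Nat.le_succ k), fun _ _ _ _ _ => rfl,
    fun v => by rw [hflow v]; ring⟩

/-- Arcs are pushed one at a time; the intermediate assignments violate conservation at `cur`, but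
`Feasible.push` does not need conservation. The field `same` ensures that the tree arcs still ahead
carry their original flow and hence are still tight. -/
theorem Aug.step {N : Net} (hN : N.Valid) {f π mark par f' : ℕ → ℕ} {k cnt cur : ℕ}
    (hT : N.Tree f π mark par cnt) (hfk : ∀ a < N.A, f a ≤ k) (hA : N.Aug f π mark par k f' cur)
    (hk : k < N.n) (hcur : cur ≠ N.s) :
    N.Aug f π mark par k (Function.update f' (N.arc (par cur)) (N.next f' (par cur)))
      (N.tail (par cur)) ∧ mark (N.tail (par cur)) < mark cur := by
  have hc := hA.cur_lt
  have hm := hA.marked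
  have he := hT.par_lt cur hc hcur hm
  have hsame := hA.same cur hc hcur hm le_rfl
  have hnext : N.next f' (par cur) = N.next f (par cur) := by unfold next; rw [hsame]
  have ht : N.Tight f' π (par cur) := by
    have := hT.tight cur hc hcur hm
    unfold Tight Residual at this ⊢
    rwa [hnext, hsame]
  have hlt := hT.mark_lt cur hc hcur hm
  have hhead := hT.head_par cur hc hcur hm
  refine ⟨⟨hN.tail_lt he, hT.mark_tail cur hc hcur hm, hA.feasible.push hN ((hA.le _ (arc_lt he)).trans hk) ht, ?_, ?_, ?_⟩, hlt⟩
  · intro a ha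
    by_cases h : a = N.arc (par cur)
    · subst h
      have := hfk _ ha
      rw [Function.update_self, hnext, next]
      omega
    · rw [Function.update_of_ne h]; exact hA.le a ha
  · intro v hv hvs hmv hle
    -- Tree arcs over the same network arc either have the same head, so `v = cur`, or are opposite,
    -- so `cur` is the parent of `v`. Both contradict that `v` is marked before `cur`.
    have hne : N.arc (par v) ≠ N.arc (par cur) := by
      intro harc
      have hhv := hT.head_par v hv hvs hmv
      have hlv := hT.mark_lt v hv hvs hmv
      rcases N.dir_cases (par v) with ⟨d1, t1, h1⟩ | ⟨d1, t1, h1⟩ <;>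
        rcases N.dir_cases (par cur) with ⟨d2, t2, h2⟩ | ⟨d2, t2, h2⟩ <;>
        rw [harc] at t1 h1
      · have : v = cur := by rw [← hhv, h1, ← h2, hhead]
        subst this; omega
      · have : N.tail (par v) = cur := by rw [t1, ← h2, hhead]
        rw [this] at hlv; omega
      · have : N.tail (par v) = cur := by rw [t1, ← h2, hhead]
        rw [this] at hlv; omega
      · have : v = cur := by rw [← hhv, h1, ← h2, hhead]
        subst this; omega
    rw [Function.update_of_ne hne]
    exact hA.same v hv hvs hmv (by omega)
  · intro v
    rw [div_push he ht.1.1, hA.div_eq, hhead]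
    ring

theorem Aug.isFlow {N : Net} {f π mark par f' : ℕ → ℕ} {k : ℕ}
    (hA : N.Aug f π mark par k f' N.s) : N.IsFlow f' (k + 1) := fun v => by
  rw [hA.div_eq]; push_cast; ring

end Net

/-! ### Path decomposition of an optimal flow. -/

namespace Net

/-- The list of arcs is a walk from `u` to `v`. -/
def IsWalk (N : Net) : ℕ → List ℕ → ℕ → Prop
  | u, [], v => u = v
  | u, a :: l, v => N.src a = u ∧ N.IsWalk (N.tgt a) l v

theorem IsWalk.concat {N : Net} {u a : ℕ} {l : List ℕ} (h : N.IsWalk u l (N.src a)) :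
    N.IsWalk u (l ++ [a]) (N.tgt a) := by
  induction l generalizing u with
  | nil => exact ⟨h.symm, rfl⟩
  | cons b l ih => exact ⟨h.1, ih h.2⟩

/-- A path from the source to `v`. -/
structure Route (N : Net) (l : List ℕ) (v : ℕ) : Prop where
  walk : N.IsWalk N.s l v
  nodup : (N.s :: l.map N.tgt).Nodup
  lt : ∀ a ∈ l, a < N.A

/-- Ensures that distinct entries of the row-wise stored incidence matrix occupy distinct cells. -/
theorem row_inj {A i j a b : ℕ} (ha : a < A) (hb : b < A) (h : i * A + a = j * A + b) :
    i = j ∧ a = b := by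
  have hA : 0 < A := by omega
  have h1 : (i * A + a) / A = i := by
    rw [mul_comm, Nat.mul_add_div hA, Nat.div_eq_of_lt ha, add_zero]
  have h2 : (j * A + b) / A = j := by
    rw [mul_comm, Nat.mul_add_div hA, Nat.div_eq_of_lt hb, add_zero]
  have : i = j := by rw [← h1, h, h2]
  subst this
  exact ⟨rfl, by omega⟩

/-- State of the path decomposition of the flow `f` after the paths of `i` players have been
found: `g` is the remaining flow, `out` the incidence matrix. -/
structure Decomp (N : Net) (f : ℕ → ℕ) (i : ℕ) (g out : ℕ → ℕ) : Prop where
  flow : ∀ v, N.div g v =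
    ((N.n : ℤ) - i) * ((if N.s = v then 1 else 0) - (if N.t = v then 1 else 0))
  sum : ∀ a < N.A, g a + ∑ j ∈ Finset.range i, out (j * N.A + a) = f a
  routes : ∀ j < i, ∃ l, N.Route l N.t ∧ ∀ a < N.A, out (j * N.A + a) = if a ∈ l then 1 else 0
  zero : ∀ j, i ≤ j → ∀ a < N.A, out (j * N.A + a) = 0

/-- State of the path decomposition while the path of player `i` is extended from `cur`. -/
structure DecompRow (N : Net) (f π : ℕ → ℕ) (i : ℕ) (g out : ℕ → ℕ) (cur : ℕ) : Prop where
  cur_lt : cur < N.V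
  flow : ∀ v, N.div g v =
    ((N.n : ℤ) - i - 1) * ((if N.s = v then 1 else 0) - (if N.t = v then 1 else 0)) +
      ((if cur = v then 1 else 0) - (if N.t = v then 1 else 0))
  sum : ∀ a < N.A, g a + ∑ j ∈ Finset.range (i + 1), out (j * N.A + a) = f a
  routes : ∀ j < i, ∃ l, N.Route l N.t ∧ ∀ a < N.A, out (j * N.A + a) = if a ∈ l then 1 else 0
  row : ∃ l, N.Route l cur ∧ (∀ u ∈ N.s :: l.map N.tgt, π u ≤ π cur) ∧
    ∀ a < N.A, out (i * N.A + a) = if a ∈ l then 1 else 0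
  zero : ∀ j, i + 1 ≤ j → ∀ a < N.A, out (j * N.A + a) = 0

theorem Decomp.row {N : Net} (hN : N.Valid) {f π g out : ℕ → ℕ} {i : ℕ}
    (h : N.Decomp f i g out) : N.DecompRow f π i g out N.s := by
  refine ⟨hN.s_lt, fun v => ?_, fun a ha => ?_, h.routes, ⟨[], ⟨rfl, by simp, by simp⟩, by simp, ?_⟩,
    fun j hj => h.zero j (by omega)⟩
  · rw [h.flow v]; ring
  · rw [Finset.sum_range_succ, h.zero i le_rfl a ha, add_zero, h.sum a ha]
  · intro a ha; simpa using h.zero i le_rfl a ha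

theorem DecompRow.next {N : Net} {f π g out : ℕ → ℕ} {i : ℕ}
    (h : N.DecompRow f π i g out N.t) : N.Decomp f (i + 1) g out := by
  refine ⟨fun v => ?_, h.sum, fun j hj => ?_, h.zero⟩
  · rw [h.flow v]; push_cast; ring
  · rcases Nat.lt_succ_iff_lt_or_eq.1 hj with hj | rfl
    · exact h.routes j hj
    · obtain ⟨l, h1, -, h2⟩ := h.row
      exact ⟨l, h1, h2⟩

/-- At `cur ≠ t` the remaining flow has net outflow at least one: the unfinished path contributes
one unit, and the later players contribute a non-negative amount. -/
theorem DecompRow.exists_out {N : Net} {f π g out : ℕ → ℕ} {i cur : ℕ}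
    (h : N.DecompRow f π i g out cur) (hi : i < N.n) (hcur : cur ≠ N.t) :
    ∃ a < N.A, N.src a = cur ∧ 0 < g a := by
  apply Net.exists_out
  rw [h.flow cur]
  have : (0 : ℤ) ≤ (N.n : ℤ) - i - 1 := by omega
  simp only [if_true, Ne.symm hcur, if_false, sub_zero]
  split_ifs <;> omega

/-- The potential increases strictly along the path, so the head of the new arc has not been visited
and the path stays simple; no cycle has to be removed. -/
theorem DecompRow.step {N : Net} (hN : N.Valid) {f π g out : ℕ → ℕ} {i cur a : ℕ}
    (hf : N.Feasible f π) (hfn : ∀ a < N.A, f a ≤ N.n)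
    (h : N.DecompRow f π i g out cur) (ha : a < N.A) (hsrc : N.src a = cur) (hg : 0 < g a) :
    N.DecompRow f π i (Function.update g a (g a - 1))
      (Function.update out (i * N.A + a) 1) (N.tgt a) := by
  have hlt : π cur < π (N.tgt a) := by
    rw [← hsrc]
    refine hf.lt_of_pos hN ha (hfn a ha) ?_
    have := h.sum a ha
    omega
  obtain ⟨l, ⟨hw, hnd, hl⟩, hmono, hrow⟩ := h.row
  have hnot : N.tgt a ∉ N.s :: l.map N.tgt := fun hmem => by
    have := hmono _ hmem
    omega
  have hal : a ∉ l := fun h => hnot (List.mem_cons_of_mem _ (List.mem_map_of_mem h))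
  have hout0 : out (i * N.A + a) = 0 := by rw [hrow a ha, if_neg hal]
  have hne : ∀ j b, b < N.A → (j ≠ i ∨ b ≠ a) →
      Function.update out (i * N.A + a) 1 (j * N.A + b) = out (j * N.A + b) := fun j b hb hjb =>
    Function.update_of_ne (fun h => by
      obtain ⟨h1, h2⟩ := row_inj hb ha h
      rcases hjb with hjb | hjb
      · exact hjb h1
      · exact hjb h2) _ _
  refine ⟨hN.tgt_lt a ha, fun v => ?_, fun b hb => ?_, fun j hj => ?_,
    ⟨l ++ [a], ⟨IsWalk.concat (hsrc ▸ hw), ?_, ?_⟩, ?_, ?_⟩, fun j hj b hb => ?_⟩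
  · rw [div_update g ha, h.flow v, hsrc]
    push_cast [Nat.one_le_iff_ne_zero.2 hg.ne']
    ring
  · rw [Finset.sum_range_succ]
    have hs : ∑ j ∈ Finset.range i, Function.update out (i * N.A + a) 1 (j * N.A + b) =
        ∑ j ∈ Finset.range i, out (j * N.A + b) :=
      Finset.sum_congr rfl fun j hj => hne j b hb (Or.inl (Finset.mem_range.1 hj).ne)
    have := h.sum b hb
    rw [Finset.sum_range_succ] at this
    rw [hs]
    by_cases hba : b = a
    · subst hba
      rw [Function.update_self, Function.update_self]
      omega
    · rw [Function.update_of_ne hba, hne i b hb (Or.inr hba)]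
      exact this
  · obtain ⟨l', h1, h2⟩ := h.routes j hj
    exact ⟨l', h1, fun b hb => by rw [hne j b hb (Or.inl hj.ne), h2 b hb]⟩
  · rw [List.map_append, ← List.cons_append, List.nodup_append]
    refine ⟨hnd, by simp, ?_⟩
    intro x hx y hy hxy
    simp only [List.map_cons, List.map_nil, List.mem_singleton] at hy
    exact hnot (hy ▸ hxy ▸ hx)
  · intro b hb
    rcases List.mem_append.1 hb with hb | hb
    · exact hl b hb
    · rw [List.mem_singleton.1 hb]; exact ha
  · intro u hu
    rw [List.map_append, ← List.cons_append, List.mem_append] at hu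
    rcases hu with hu | hu
    · exact (hmono u hu).trans hlt.le
    · simp only [List.map_cons, List.map_nil, List.mem_singleton] at hu
      rw [hu]
  · intro b hb
    by_cases hba : b = a
    · subst hba; simp
    · rw [hne i b hb (Or.inr hba), hrow b hb]
      simp [hba]
  · rw [hne j b hb (Or.inl (by omega))]
    exact h.zero j hj b hb

/-- At the end of the path decomposition, no flow remains. -/
theorem Decomp.sum_eq {N : Net} (hN : N.Valid) {f π g out : ℕ → ℕ}
    (hf : N.Feasible f π) (hfn : ∀ a < N.A, f a ≤ N.n) (h : N.Decomp f N.n g out) {a : ℕ}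
    (ha : a < N.A) : ∑ j ∈ Finset.range N.n, out (j * N.A + a) = f a := by
  have h0 := sum_mul_div hN g π
  -- What remains is a circulation, so the sum of `g a * (π (src a) - π (tgt a))` vanishes. Its
  -- terms are non-positive, and negative wherever `g a > 0`.
  rw [Finset.sum_eq_zero fun v _ => by rw [h.flow v]; ring, eq_comm, ← neg_eq_zero,
    ← Finset.sum_neg_distrib, Finset.sum_eq_zero_iff_of_nonneg] at h0
  · have h1 := h0 a (Finset.mem_range.2 ha)
    have h2 := h.sum a ha
    rcases Nat.eq_zero_or_pos (g a) with hg | hg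
    · omega
    · have h3 := hf.lt_of_pos hN ha (hfn a ha) (by omega)
      have h4 : (g a : ℤ) * ((π (N.tgt a) : ℤ) - π (N.src a)) = 0 := by linarith
      rcases mul_eq_zero.1 h4 with h5 | h5 <;> omega
  · intro b hb
    rw [Finset.mem_range] at hb
    have h2 := h.sum b hb
    rcases Nat.eq_zero_or_pos (g b) with hg | hg
    · simp [hg]
    · have h3 := hf.lt_of_pos hN hb (hfn b hb) (by omega)
      have : (0 : ℤ) ≤ (g b : ℤ) * ((π (N.tgt b) : ℤ) - π (N.src b)) :=
        mul_nonneg (by positivity) (by omega)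
      linarith

end Net

/-! ## The algorithm -/

namespace RealRAM

namespace NExp

/-- The scalar variable stored in cell `0` of array `X`. -/
def var (X : ℕ) : NExp := .get X (.const 0)

def numV : NExp := .get 0 (.const 0)
def numA : NExp := .get 0 (.const 1)
def numN : NExp := .get 0 (.const 2)
def source : NExp := .get 0 (.const 3)
def sink : NExp := .get 0 (.const 4)

/-! Expressions for residual arcs; the flow is stored in array `5`, the vertex potential in
array `6` and the factors of the arc costs in array `4`. -/

def dir (e : NExp) : NExp := .sub (.const 1) (.sub numA e)
def arc (e : NExp) : NExp := .sub e (.mul numA (dir e))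
def tail (e : NExp) : NExp :=
  .add (.mul (.get 1 (arc e)) (.sub (.const 1) (dir e))) (.mul (.get 2 (arc e)) (dir e))
def head (e : NExp) : NExp :=
  .add (.mul (.get 1 (arc e)) (dir e)) (.mul (.get 2 (arc e)) (.sub (.const 1) (dir e)))
def flow (e : NExp) : NExp := .get 5 (arc e)
def next (e : NExp) : NExp := .sub (.add (flow e) (.const 1)) (.mul (.const 2) (dir e))
def weight (a k : NExp) : NExp :=
  .mul k (.get 4 (.add (.mul a (.add numN (.const 1))) k))
def slack (e : NExp) : NExp :=
  .sub (.add (weight (arc e) (next e)) (.get 6 (tail e)))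
    (.add (weight (arc e) (flow e)) (.get 6 (head e)))

end NExp

namespace Program

open NExp

/-- Assignment to a scalar variable. -/
def set (X : ℕ) (e : NExp) : Program := .nset X (.const 0) e

/-- Replaces the cell `q` of array `4` by `B ^ r`, where `r` is the number of entries of the cost
table that are smaller than the entry in cell `q`. -/
def weights : Program :=
  forLoop 17 (.mul numA (.add numN (.const 1))) (.seq (.nset 4 (var 17) (.const 1))
    (forLoop 11 (.mul numA (.add numN (.const 1)))
      (.branch (.not (.rle (.get 0 (var 17)) (.get 0 (var 11))))
        (.nset 4 (var 17) (.mul (.get 4 (var 17)) (.add (.mul numN numA) (.const 1)))) .skip)))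

/-- Searches for a residual arc of minimal reduced cost that leaves the set of marked vertices. -/
def scan : Program :=
  .seq (set 13 (.mul (.const 2) numA)) (forLoop 11 (.mul (.const 2) numA)
    (.branch (.and (.not (.nle (.get 7 (tail (var 11))) (.const 0)))
        (.and (.nle (.get 7 (head (var 11))) (.const 0)) (.nle (dir (var 11)) (flow (var 11)))))
      (.branch (.and (.not (.nle (.mul (.const 2) numA) (var 13)))
          (.nle (var 12) (slack (var 11))))
        .skip (.seq (set 12 (slack (var 11))) (set 13 (var 11)))) .skip))

/-- Increases the potential of all unmarked vertices. -/
def raise : Program :=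
  forLoop 14 numV (.branch (.nle (.get 7 (var 14)) (.const 0))
    (.nset 6 (var 14) (.add (.get 6 (var 14)) (var 12))) .skip)

/-- Marks the head of the residual arc that has been found. -/
def mark : Program :=
  .seq (.nset 8 (head (var 13)) (var 13)) (.seq (.nset 7 (head (var 13)) (var 15))
    (set 15 (.add (var 15) (.const 1))))

/-- Unmarks all vertices. -/
def clear : Program := forLoop 14 numV (.nset 7 (var 14) (.const 0))

/-- Dijkstra's algorithm. -/
def search : Program :=
  .seq clear (.seq (.seq (.nset 7 source (.const 1)) (set 15 (.const 2)))
    (.loop (.nle (.get 7 sink) (.const 0)) (.seq scan (.seq raise mark))))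

/-- Augments the flow along the path found by Dijkstra's algorithm. -/
def augment : Program :=
  .seq (set 16 sink) (.loop (.not (.and (.nle (var 16) source) (.nle source (var 16))))
    (.seq (.nset 5 (arc (.get 8 (var 16))) (next (.get 8 (var 16))))
      (set 16 (tail (.get 8 (var 16))))))

/-- Computes a flow of minimal cost by successive shortest paths. -/
def flowProgram : Program := forLoop 17 numN (.seq search augment)

/-- Finds an arc that carries flow and leaves the current vertex. -/
def pick : Program :=
  forLoop 11 numA (.branch (.and (.and (.nle (var 16) (.get 1 (var 11)))
      (.nle (.get 1 (var 11)) (var 16))) (.nle (.const 1) (.get 5 (var 11))))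
    (set 13 (var 11)) .skip)

/-- Moves a unit of flow on the chosen arc to the path of the current player. -/
def move : Program :=
  .seq (.nset 5 (var 13) (.sub (.get 5 (var 13)) (.const 1)))
    (.seq (.nset 3 (.add (.mul (var 17) numA) (var 13)) (.const 1)) (set 16 (.get 2 (var 13))))

/-- Decomposes the flow into paths. -/
def decompose : Program :=
  forLoop 17 numN (.seq (set 16 source)
    (.loop (.not (.and (.nle (var 16) sink) (.nle sink (var 16)))) (.seq pick move)))

/-- Computes a strong Nash equilibrium of a bottleneck routing game. -/
def equilibrium : Program := .seq weights (.seq flowProgram decompose)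

end Program

/-! ### Correctness and iteration bounds of the programs. -/

/-- The memory contains the network `N`. -/
structure Loaded (N : Net) (m : Memory) : Prop where
  V : m.nat 0 0 = N.V
  A : m.nat 0 1 = N.A
  n : m.nat 0 2 = N.n
  s : m.nat 0 3 = N.s
  t : m.nat 0 4 = N.t
  src : m.nat 1 = N.src
  tgt : m.nat 2 = N.tgt
  E : m.nat 4 = N.E

/-- The network occupies the arrays 0, 1, 2 and 4, to which neither `flowProgram` nor `decompose`
writes. -/
theorem Loaded.of_frame {N : Net} {m m' : Memory} (h : Loaded N m) {L : List ℕ} (hF : Frame L m m')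
    (h0 : 0 ∉ L := by decide) (h1 : 1 ∉ L := by decide) (h2 : 2 ∉ L := by decide)
    (h4 : 4 ∉ L := by decide) : Loaded N m' := by
  obtain ⟨V, A, n, s, t, src, tgt, E⟩ := h
  constructor
  all_goals first
    | rwa [hF.2 0 h0]
    | rwa [hF.2 1 h1]
    | rwa [hF.2 2 h2]
    | rwa [hF.2 4 h4]

theorem Loaded.eval_dir {N : Net} {m : Memory} (h : Loaded N m) (e : NExp) : (NExp.dir e).eval m = N.dir (e.eval m) := by
  simp [NExp.dir, NExp.numA, NExp.eval, h.A, Net.dir]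

theorem Loaded.eval_arc {N : Net} {m : Memory} (h : Loaded N m) (e : NExp) : (NExp.arc e).eval m = N.arc (e.eval m) := by
  simp [NExp.arc, NExp.numA, NExp.eval, h.A, Net.arc, h.eval_dir]

theorem Loaded.eval_tail {N : Net} {m : Memory} (h : Loaded N m) (e : NExp) : (NExp.tail e).eval m = N.tail (e.eval m) := by
  simp [NExp.tail, NExp.eval, h.src, h.tgt, Net.tail, h.eval_dir, h.eval_arc]

theorem Loaded.eval_head {N : Net} {m : Memory} (h : Loaded N m) (e : NExp) : (NExp.head e).eval m = N.head (e.eval m) := by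
  simp [NExp.head, NExp.eval, h.src, h.tgt, Net.head, h.eval_dir, h.eval_arc]

theorem Loaded.eval_flow {N : Net} {m : Memory} (h : Loaded N m) (e : NExp) : (NExp.flow e).eval m = m.nat 5 (N.arc (e.eval m)) := by
  simp [NExp.flow, NExp.eval, h.eval_arc]

theorem Loaded.eval_next {N : Net} {m : Memory} (h : Loaded N m) (e : NExp) : (NExp.next e).eval m = N.next (m.nat 5) (e.eval m) := by
  simp [NExp.next, NExp.eval, h.eval_flow, h.eval_dir, Net.next]

theorem Loaded.eval_weight {N : Net} {m : Memory} (h : Loaded N m) (e k : NExp) :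
    (NExp.weight e k).eval m = N.w (e.eval m) (k.eval m) := by
  simp [NExp.weight, NExp.eval, NExp.numN, h.n, h.E, Net.w]

theorem Loaded.eval_slack {N : Net} {m : Memory} (h : Loaded N m) (e : NExp) :
    (NExp.slack e).eval m = N.slack (m.nat 5) (m.nat 6) (e.eval m) := by
  simp [NExp.slack, NExp.eval, h.eval_weight, h.eval_arc, h.eval_next, h.eval_flow, h.eval_tail,
    h.eval_head, Net.slack]

open NExp Program

theorem scan_runs {b : ℕ} {N : Net} {m : Memory} (hl : Loaded N m) (hb : 2 * N.A ≤ b)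
    (hex : ∃ e < 2 * N.A, N.Adm (m.nat 5) (m.nat 7) e) :
    Runs b scan m fun m' =>
      (m'.nat 13 0 < 2 * N.A ∧ N.Adm (m.nat 5) (m.nat 7) (m'.nat 13 0) ∧
        m'.nat 12 0 = N.slack (m.nat 5) (m.nat 6) (m'.nat 13 0) ∧
        ∀ e < 2 * N.A, N.Adm (m.nat 5) (m.nat 7) e →
          m'.nat 12 0 ≤ N.slack (m.nat 5) (m.nat 6) e) ∧ Frame [11, 12, 13] m m' := by
  refine Runs.seq (Runs.of_loopFree rfl ?_)
  set m₁ := (set 13 (.mul (.const 2) numA)).run m with hm₁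
  have hF₁ : Frame [11, 12, 13] m m₁ := ⟨rfl, fun B hB => Memory.setNat_nat_of_ne _ _ _ (by
    rintro rfl; simp at hB)⟩
  have h13 : m₁.nat 13 0 = 2 * N.A := by
    simp [hm₁, Program.set, Program.run, NExp.eval, Memory.setNat_nat, numA, hl.A]
  -- The value `2 * A` in array 13 is not a residual arc and means that nothing has been found yet;
  -- this is the first alternative of the invariant.
  refine Runs.mono (Runs.forLoop [11, 12, 13] (2 * N.A) (fun i m' =>
    (m'.nat 13 0 = 2 * N.A ∧ ∀ e < i, ¬ N.Adm (m.nat 5) (m.nat 7) e) ∨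
    (m'.nat 13 0 < 2 * N.A ∧ N.Adm (m.nat 5) (m.nat 7) (m'.nat 13 0) ∧
        m'.nat 12 0 = N.slack (m.nat 5) (m.nat 6) (m'.nat 13 0) ∧
        ∀ e < i, N.Adm (m.nat 5) (m.nat 7) e →
          m'.nat 12 0 ≤ N.slack (m.nat 5) (m.nat 6) e)) rfl (by decide) (by decide) (by decide)
    hb ?_ ?_ ?_) ?_
  · intro m' hF
    have := hl.of_frame (hF₁.trans hF)
    simp [NExp.eval, numA, this.A]
  · left
    simp [Memory.setNat_nat, h13]
  · intro i hi m' hF h11 hI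
    have hF' := hF₁.trans hF
    have hl' := hl.of_frame hF'
    have e5 : m'.nat 5 = m.nat 5 := hF'.2 5 (by decide)
    have e6 : m'.nat 6 = m.nat 6 := hF'.2 6 (by decide)
    have e7 : m'.nat 7 = m.nat 7 := hF'.2 7 (by decide)
    apply Runs.of_loopFree rfl
    have hadm : (Test.and (.not (.nle (.get 7 (tail (var 11))) (.const 0)))
        (.and (.nle (.get 7 (head (var 11))) (.const 0))
          (.nle (dir (var 11)) (flow (var 11))))).Holds m' ↔ N.Adm (m.nat 5) (m.nat 7) i := by
      simp [Test.Holds, NExp.eval, hl'.eval_tail, hl'.eval_head, hl'.eval_dir, hl'.eval_flow,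
        var, h11, e5, e7, Net.Adm]
    have hbt : (Test.and (.not (.nle (.mul (.const 2) numA) (var 13)))
          (.nle (var 12) (slack (var 11)))).Holds m' ↔
        m'.nat 13 0 < 2 * N.A ∧ m'.nat 12 0 ≤ N.slack (m.nat 5) (m.nat 6) i := by
      simp [Test.Holds, NExp.eval, hl'.eval_slack, var, h11, e5, e6, numA, hl'.A]
    rw [Program.run]
    by_cases ha : N.Adm (m.nat 5) (m.nat 7) i
    · rw [if_pos (hadm.2 ha), Program.run]
      by_cases hb' : m'.nat 13 0 < 2 * N.A ∧ m'.nat 12 0 ≤ N.slack (m.nat 5) (m.nat 6) i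
      · rw [if_pos (hbt.2 hb'), Program.run]
        simp only [Memory.setNat_nat_of_ne _ _ _ (show 13 ≠ 11 by decide),
          Memory.setNat_nat_of_ne _ _ _ (show 12 ≠ 11 by decide)]
        rcases hI with hI | ⟨h1, h2, h3, h4⟩
        · omega
        · refine Or.inr ⟨h1, h2, h3, fun e he hae => ?_⟩
          rcases Nat.lt_succ_iff_lt_or_eq.1 he with he | rfl
          · exact h4 e he hae
          · exact hb'.2
      · rw [if_neg fun h => hb' (hbt.1 h)]
        have h13' : ((Program.seq (set 12 (slack (var 11))) (set 13 (var 11))).run m').nat 13 0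
            = i := by
          simp [Program.run, Program.set, Memory.setNat_nat, NExp.eval, var, h11]
        have h12' : ((Program.seq (set 12 (slack (var 11))) (set 13 (var 11))).run m').nat 12 0
            = N.slack (m.nat 5) (m.nat 6) i := by
          simp [Program.run, Program.set, Memory.setNat_nat, NExp.eval, hl'.eval_slack, var, h11,
            e5, e6]
        simp only [Memory.setNat_nat_of_ne _ _ _ (show 13 ≠ 11 by decide),
          Memory.setNat_nat_of_ne _ _ _ (show 12 ≠ 11 by decide), h13', h12']
        refine Or.inr ⟨hi, ha, trivial, fun e he hae => ?_⟩
        rcases Nat.lt_succ_iff_lt_or_eq.1 he with he | rfl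
        · rcases hI with ⟨-, h2⟩ | ⟨h1, h2, h3, h4⟩
          · exact absurd hae (h2 e he)
          · have := h4 e he hae
            have : ¬ m'.nat 12 0 ≤ N.slack (m.nat 5) (m.nat 6) i := fun h => hb' ⟨h1, h⟩
            omega
        · exact le_rfl
    · rw [if_neg fun h => ha (hadm.1 h), Program.run]
      simp only [Memory.setNat_nat_of_ne _ _ _ (show 13 ≠ 11 by decide),
        Memory.setNat_nat_of_ne _ _ _ (show 12 ≠ 11 by decide)]
      rcases hI with ⟨h1, h2⟩ | ⟨h1, h2, h3, h4⟩
      · refine Or.inl ⟨h1, fun e he => ?_⟩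
        rcases Nat.lt_succ_iff_lt_or_eq.1 he with he | rfl
        · exact h2 e he
        · exact ha
      · refine Or.inr ⟨h1, h2, h3, fun e he hae => ?_⟩
        rcases Nat.lt_succ_iff_lt_or_eq.1 he with he | rfl
        · exact h4 e he hae
        · exact absurd hae ha
  · rintro m' ⟨hI, hF⟩
    refine ⟨?_, hF₁.trans hF⟩
    rcases hI with ⟨-, h2⟩ | h
    · obtain ⟨e, he, hae⟩ := hex
      exact absurd hae (h2 e he)
    · exact h

end RealRAM

namespace RealRAM
open NExp Program

theorem raise_runs {b : ℕ} {N : Net} {m : Memory} (hl : Loaded N m) (hb : N.V ≤ b) :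
    Runs b raise m fun m' =>
      (∀ v < N.V, m'.nat 6 v = if m.nat 7 v = 0 then m.nat 6 v + m.nat 12 0 else m.nat 6 v) ∧
        Frame [6, 14] m m' := by
  refine (Runs.forLoop [6, 14] N.V (fun i m' => ∀ v, m'.nat 6 v =
    if v < i ∧ m.nat 7 v = 0 then m.nat 6 v + m.nat 12 0 else m.nat 6 v) rfl
    (by decide) (by decide) (by decide) hb ?_ ?_ ?_).mono ?_
  · intro m' hF
    have := hl.of_frame hF
    simp [NExp.eval, numV, this.V]
  · intro v
    simp [Memory.setNat_nat]
  · intro i hi m' hF h14 hI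
    have e7 : m'.nat 7 = m.nat 7 := hF.2 7 (by decide)
    have e12 : m'.nat 12 = m.nat 12 := hF.2 12 (by decide)
    apply Runs.of_loopFree rfl
    intro v
    have hb : (Test.nle (.get 7 (var 14)) (.const 0)).Holds m' ↔ m.nat 7 i = 0 := by
      simp [Test.Holds, NExp.eval, var, h14, e7]
    rw [Memory.setNat_nat_of_ne _ _ _ (by decide), Program.run]
    by_cases h0 : m.nat 7 i = 0
    · rw [if_pos (hb.2 h0)]
      simp only [Program.run, Memory.setNat_nat, NExp.eval, var, h14, if_true, hI, e12]
      by_cases hv : v = i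
      · subst hv; simp [h0]
      · have : v < i + 1 ↔ v < i := by omega
        simp [hv, this]
    · rw [if_neg fun h => h0 (hb.1 h)]
      simp only [Program.run, hI]
      by_cases hv : v = i
      · subst hv; simp [h0]
      · have : v < i + 1 ↔ v < i := by omega
        simp [this]
  · rintro m' ⟨hI, hF⟩
    exact ⟨fun v hv => by simpa [hv] using hI v, hF⟩

theorem clear_runs {b : ℕ} {N : Net} {m : Memory} (hl : Loaded N m) (hb : N.V ≤ b) :
    Runs b clear m fun m' => (∀ v < N.V, m'.nat 7 v = 0) ∧ Frame [7, 14] m m' := by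
  refine (Runs.forLoop [7, 14] N.V (fun i m' => ∀ v < i, m'.nat 7 v = 0) rfl
    (by decide) (by decide) (by decide) hb ?_ ?_ ?_).mono fun m' h => h
  · intro m' hF
    have := hl.of_frame hF
    simp [NExp.eval, numV, this.V]
  · simp
  · intro i hi m' hF h14 hI
    apply Runs.of_loopFree rfl
    intro v hv
    simp only [Program.run, Memory.setNat_nat, NExp.eval, var, h14]
    by_cases h : v = i
    · simp [h]
    · simpa [h] using hI v (by omega)

theorem mark_run {N : Net} {m : Memory} (hl : Loaded N m) :
    (mark.run m).nat 7 = Function.update (m.nat 7) (N.head (m.nat 13 0)) (m.nat 15 0) ∧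
    (mark.run m).nat 8 = Function.update (m.nat 8) (N.head (m.nat 13 0)) (m.nat 13 0) ∧
    (mark.run m).nat 15 0 = m.nat 15 0 + 1 ∧ Frame [7, 8, 15] m (mark.run m) := by
  have hl' : Loaded N (m.setNat 8 ((head (var 13)).eval m) ((var 13).eval m)) :=
    hl.of_frame (L := [8]) ⟨rfl, fun B hB => Memory.setNat_nat_of_ne _ _ _ (by simpa using hB)⟩
  have hF : Frame [7, 8, 15] m (mark.run m) := by
    refine ⟨rfl, fun B hB => ?_⟩
    simp only [List.mem_cons, List.not_mem_nil, or_false, not_or] at hB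
    simp only [mark, Program.run, Program.set]
    rw [Memory.setNat_nat_of_ne _ _ _ hB.2.2, Memory.setNat_nat_of_ne _ _ _ hB.1,
      Memory.setNat_nat_of_ne _ _ _ hB.2.1]
  refine ⟨?_, ?_, ?_, hF⟩
  · have hh : (head (var 13)).eval (m.setNat 8 ((head (var 13)).eval m) ((var 13).eval m)) =
        N.head (m.nat 13 0) := by
      rw [hl'.eval_head]
      simp [Memory.setNat_nat, NExp.eval, var]
    ext v
    simp only [mark, Program.run, Program.set, hh]
    simp [Memory.setNat_nat, NExp.eval, var, Function.update_apply]
  · ext v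
    simp [mark, Program.run, Program.set, Memory.setNat_nat, hl.eval_head, NExp.eval, var,
      Function.update_apply]
  · simp [mark, Program.run, Program.set, Memory.setNat_nat, NExp.eval, var]

/-- While the sink is unmarked, `Valid.exists_adm` provides an arc for the scan. Every iteration
marks a further vertex, so there are at most `V` of them. -/
theorem search_runs {b : ℕ} {N : Net} (hN : N.Valid) {m : Memory} (hl : Loaded N m)
    (hbV : N.V ≤ b) (hbA : 2 * N.A ≤ b) (hf : N.Feasible (m.nat 5) (m.nat 6))
    (hfn : ∀ a < N.A, m.nat 5 a < N.n) :
    Runs b search m fun m' =>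
      (∃ cnt, N.Tree (m.nat 5) (m'.nat 6) (m'.nat 7) (m'.nat 8) cnt) ∧ m'.nat 7 N.t ≠ 0 ∧
        Frame [6, 7, 8, 11, 12, 13, 14, 15] m m' := by
  have main : Runs b search m fun m' =>
      (∃ cnt, N.Tree (m.nat 5) (m'.nat 6) (m'.nat 7) (m'.nat 8) cnt) ∧ m'.nat 7 N.t ≠ 0 := by
    refine Runs.seq ((clear_runs hl hbV).mono ?_)
    rintro m₁ ⟨h7, hF₁⟩
    have hl₁ := hl.of_frame hF₁
    refine Runs.seq (Runs.of_loopFree rfl ?_)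
    set m₂ := (Program.seq (.nset 7 source (.const 1)) (Program.set 15 (.const 2))).run m₁ with hm₂
    have hF₂ : Frame [7, 15] m₁ m₂ := by
      refine ⟨rfl, fun B hB => ?_⟩
      simp only [List.mem_cons, List.not_mem_nil, or_false, not_or] at hB
      simp only [hm₂, Program.run, Program.set]
      rw [Memory.setNat_nat_of_ne _ _ _ hB.2, Memory.setNat_nat_of_ne _ _ _ hB.1]
    have h15 : m₂.nat 15 0 = 2 := by
      simp [hm₂, Program.run, Program.set, Memory.setNat_nat, NExp.eval]
    have h7' : ∀ v < N.V, m₂.nat 7 v = if v = N.s then 1 else 0 := by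
      intro v hv
      simp [hm₂, Program.run, Program.set, Memory.setNat_nat, NExp.eval, source, hl₁.s, h7 v hv]
    have hF₂' : Frame [6, 7, 8, 11, 12, 13, 14, 15] m m₂ :=
      (hF₁.mono (by decide)).trans (hF₂.mono (by decide))
    have e6 : m₂.nat 6 = m.nat 6 := by
      rw [hF₂.2 6 (by decide), hF₁.2 6 (by decide)]
    refine (Runs.loop (fun m' => N.Tree (m.nat 5) (m'.nat 6) (m'.nat 7) (m'.nat 8) (m'.nat 15 0) ∧
      Frame [6, 7, 8, 11, 12, 13, 14, 15] m m') (fun m' => N.unmarked (m'.nat 7)) ?_ ⟨?_, hF₂'⟩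
      ?_).mono ?_
    · rintro m₃ ⟨hT, hF₃⟩ hc
      have hl₃ := hl.of_frame hF₃
      have e5 : m₃.nat 5 = m.nat 5 := hF₃.2 5 (by decide)
      have ht : m₃.nat 7 N.t = 0 := by
        simpa [Test.Holds, NExp.eval, sink, hl₃.t] using hc
      refine Runs.seq ((scan_runs hl₃ hbA (hN.exists_adm hT.source ht)).mono ?_)
      rintro m₄ ⟨⟨h1, h2, h3, h4⟩, hF₄⟩
      have hl₄ := hl₃.of_frame hF₄
      refine Runs.seq ((raise_runs hl₄ hbV).mono ?_)
      rintro m₅ ⟨h5, hF₅⟩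
      have hl₅ := hl₄.of_frame hF₅
      refine Runs.of_loopFree rfl ?_
      obtain ⟨i1, i2, i3, hF₆⟩ := mark_run hl₅
      have hF₆' : Frame [6, 7, 8, 11, 12, 13, 14, 15] m (mark.run m₅) :=
        hF₃.trans ((hF₄.mono (by decide)).trans ((hF₅.mono (by decide)).trans
          (hF₆.mono (by decide))))
      have j13 : m₅.nat 13 = m₄.nat 13 := hF₅.2 13 (by decide)
      have j15 : m₅.nat 15 = m₃.nat 15 := by rw [hF₅.2 15 (by decide), hF₄.2 15 (by decide)]
      have j7 : m₅.nat 7 = m₃.nat 7 := by rw [hF₅.2 7 (by decide), hF₄.2 7 (by decide)]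
      have j8 : m₅.nat 8 = m₃.nat 8 := by rw [hF₅.2 8 (by decide), hF₄.2 8 (by decide)]
      have j6 : (mark.run m₅).nat 6 = m₅.nat 6 := hF₆.2 6 (by decide)
      have j67 : m₄.nat 7 = m₃.nat 7 := hF₄.2 7 (by decide)
      have j66 : m₄.nat 6 = m₃.nat 6 := hF₄.2 6 (by decide)
      rw [e5] at h2 h3 h4
      have hT' := hT.step hN hfn h1 h2 (fun e' he' ha => by rw [← h3]; exact h4 e' he' ha)
        (π' := m₅.nat 6) (fun v hv => by rw [h5 v hv, j67, j66, h3])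
      refine ⟨⟨?_, hF₆'⟩, ?_⟩
      · rw [i1, i2, i3, j6, j13, j15, j7, j8]
        exact hT'
      · have c1 := hT.count
        have c2 := hT'.count
        rw [i1, j13, j15, j7]
        omega
    · rw [h15]
      exact Net.tree_init hN (by rw [e6]; exact hf) h7'
    · refine le_trans ?_ hbV
      unfold Net.unmarked
      exact (Finset.card_filter_le _ _).trans (by simp)
    · rintro m' ⟨⟨hT, hF⟩, hc⟩
      have hl' := hl.of_frame hF
      refine ⟨⟨_, hT⟩, ?_⟩
      simpa [Test.Holds, NExp.eval, sink, hl'.t] using hc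
  refine (main.frame (L := [6, 7, 8, 11, 12, 13, 14, 15]) rfl (by decide)).mono ?_
  rintro m' ⟨⟨h1, h2⟩, h3⟩
  exact ⟨h1, h2, h3⟩

/-- The marks decrease strictly on the way back to the source and are at most `V`, which bounds the
number of iterations. -/
theorem augment_runs {b : ℕ} {N : Net} (hN : N.Valid) {m : Memory} (hl : Loaded N m)
    (hbV : N.V ≤ b) {k cnt : ℕ} (hk : k < N.n)
    (hT : N.Tree (m.nat 5) (m.nat 6) (m.nat 7) (m.nat 8) cnt) (ht : m.nat 7 N.t ≠ 0)
    (hfk : ∀ a < N.A, m.nat 5 a ≤ k) (hflow : N.IsFlow (m.nat 5) k) :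
    Runs b augment m fun m' => (N.Feasible (m'.nat 5) (m.nat 6) ∧ N.IsFlow (m'.nat 5) (k + 1) ∧
      ∀ a < N.A, m'.nat 5 a ≤ k + 1) ∧ Frame [5, 16] m m' := by
  refine Runs.frame ?_ rfl (by decide)
  refine Runs.seq (Runs.of_loopFree rfl ?_)
  set m₁ := (Program.set 16 sink).run m with hm₁
  have hF₁ : Frame [5, 16] m m₁ := ⟨rfl, fun B hB => Memory.setNat_nat_of_ne _ _ _ (by
    rintro rfl; simp at hB)⟩
  have h16 : m₁.nat 16 0 = N.t := by
    simp [hm₁, Program.set, Program.run, NExp.eval, Memory.setNat_nat, sink, hl.t]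
  have h5 : m₁.nat 5 = m.nat 5 := Memory.setNat_nat_of_ne _ _ _ (by decide)
  have hle : ∀ v < N.V, m.nat 7 v ≤ N.V := fun v hv => by
    have h1 := hT.lt_cnt v hv
    have h2 := hT.count
    omega
  refine (Runs.loop (fun m' =>
    N.Aug (m.nat 5) (m.nat 6) (m.nat 7) (m.nat 8) k (m'.nat 5) (m'.nat 16 0) ∧
      Frame [5, 16] m m') (fun m' => m.nat 7 (m'.nat 16 0)) ?_ ⟨?_, hF₁⟩ ?_).mono ?_
  · rintro m' ⟨hA, hF⟩ hc
    have hl' := hl.of_frame hF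
    have hcur : m'.nat 16 0 ≠ N.s := by
      intro h
      simp [Test.Holds, NExp.eval, source, hl'.s, var, h] at hc
    have e8 : m'.nat 8 = m.nat 8 := hF.2 8 (by decide)
    obtain ⟨hA', hlt⟩ := hA.step hN hT hfk hk hcur
    refine Runs.of_loopFree rfl ?_
    set m₂ := m'.setNat 5 ((arc (.get 8 (var 16))).eval m') ((next (.get 8 (var 16))).eval m')
      with hm₂
    have hl₂ : Loaded N m₂ :=
      hl'.of_frame (L := [5]) ⟨rfl, fun B hB => Memory.setNat_nat_of_ne _ _ _ (by simpa using hB)⟩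
    have k8 : m₂.nat 8 = m.nat 8 := by rw [hm₂, Memory.setNat_nat_of_ne _ _ _ (by decide), e8]
    have k16 : m₂.nat 16 = m'.nat 16 := by rw [hm₂, Memory.setNat_nat_of_ne _ _ _ (by decide)]
    have r5 : ((Program.seq (.nset 5 (arc (.get 8 (var 16))) (next (.get 8 (var 16))))
        (Program.set 16 (tail (.get 8 (var 16))))).run m').nat 5 =
        Function.update (m'.nat 5) (N.arc (m.nat 8 (m'.nat 16 0)))
          (N.next (m'.nat 5) (m.nat 8 (m'.nat 16 0))) := by
      simp only [Program.run, Program.set, Memory.setNat_nat_of_ne _ _ _ (show 5 ≠ 16 by decide),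
        Memory.setNat_nat_self, hl'.eval_arc, hl'.eval_next, NExp.eval, var, e8]
    have r16 : ((Program.seq (.nset 5 (arc (.get 8 (var 16))) (next (.get 8 (var 16))))
        (Program.set 16 (tail (.get 8 (var 16))))).run m').nat 16 0 =
        N.tail (m.nat 8 (m'.nat 16 0)) := by
      simp only [Program.run, Program.set]
      rw [← hm₂, Memory.setNat_nat]
      simp [hl₂.eval_tail, NExp.eval, var, k8, k16]
    refine ⟨⟨by rw [r5, r16]; exact hA', hF.trans ?_⟩, by rw [r16]; exact hlt⟩
    refine ⟨rfl, fun B hB => ?_⟩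
    simp only [List.mem_cons, List.not_mem_nil, or_false, not_or] at hB
    simp only [Program.run, Program.set]
    rw [Memory.setNat_nat_of_ne _ _ _ hB.2, Memory.setNat_nat_of_ne _ _ _ hB.1]
  · rw [h5, h16]
    exact Net.Aug.init hN hT ht hfk hflow
  · rw [h16]
    exact (hle _ hN.t_lt).trans hbV
  · rintro m' ⟨⟨hA, hF⟩, hc⟩
    have hl' := hl.of_frame hF
    have hcur : m'.nat 16 0 = N.s := by
      simp [Test.Holds, NExp.eval, source, hl'.s, var] at hc
      omega
    rw [hcur] at hA
    exact ⟨hA.feasible, hA.isFlow, hA.le⟩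

/-- The potential is carried over from round to round. Reduced costs thus stay non-negative, and
Dijkstra's algorithm applies although backward arcs have negative costs. -/
theorem flowProgram_runs {b : ℕ} {N : Net} (hN : N.Valid) {m : Memory} (hl : Loaded N m)
    (hbV : N.V ≤ b) (hbA : 2 * N.A ≤ b) (hbn : N.n ≤ b) (h5 : m.nat 5 = 0) (h6 : m.nat 6 = 0) :
    Runs b flowProgram m fun m' => (N.Feasible (m'.nat 5) (m'.nat 6) ∧
      N.IsFlow (m'.nat 5) N.n ∧ ∀ a < N.A, m'.nat 5 a ≤ N.n) ∧
      Frame [5, 6, 7, 8, 11, 12, 13, 14, 15, 16, 17] m m' := by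
  refine Runs.forLoop _ N.n (fun k m' => N.Feasible (m'.nat 5) (m'.nat 6) ∧
      N.IsFlow (m'.nat 5) k ∧ ∀ a < N.A, m'.nat 5 a ≤ k) rfl
    (by decide) (by decide) (by decide) hbn ?_ ?_ ?_
  · intro m' hF
    have := hl.of_frame hF
    simp [NExp.eval, numN, this.n]
  · simp only [Memory.setNat_nat_of_ne _ _ _ (show 5 ≠ 17 by decide),
      Memory.setNat_nat_of_ne _ _ _ (show 6 ≠ 17 by decide), h5, h6]
    refine ⟨?_, fun v => by simp [Net.div], by simp⟩
    -- For the zero flow and zero potential, the forward constraints hold since `w a 0 = 0`, and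
    -- there is no flow to withdraw.
    rw [Net.feasible_iff]
    intro a ha
    simp [Net.w]
  · rintro k hk m' hF - ⟨h1, h2, h3⟩
    have hl' := hl.of_frame hF
    refine Runs.seq ((search_runs hN hl' hbV hbA h1 fun a ha => (h3 a ha).trans_lt hk).mono ?_)
    rintro m₁ ⟨⟨cnt, hT⟩, ht, hF₁⟩
    have e5 : m₁.nat 5 = m'.nat 5 := hF₁.2 5 (by decide)
    rw [← e5] at hT h2 h3
    refine (augment_runs hN (hl'.of_frame hF₁) hbV hk hT ht h3 h2).mono ?_
    rintro m₂ ⟨⟨i1, i2, i3⟩, hF₂⟩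
    simp only [Memory.setNat_nat_of_ne _ _ _ (show 5 ≠ 17 by decide),
      Memory.setNat_nat_of_ne _ _ _ (show 6 ≠ 17 by decide)]
    rw [hF₂.2 6 (by decide)]
    exact ⟨i1, i2, i3⟩

theorem pick_runs {b : ℕ} {N : Net} {m : Memory} (hl : Loaded N m) (hbA : N.A ≤ b)
    (hex : ∃ a < N.A, N.src a = m.nat 16 0 ∧ 0 < m.nat 5 a) :
    Runs b pick m fun m' => (m'.nat 13 0 < N.A ∧ N.src (m'.nat 13 0) = m.nat 16 0 ∧
      0 < m.nat 5 (m'.nat 13 0)) ∧ Frame [11, 13] m m' := by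
  refine (Runs.forLoop [11, 13] N.A (fun i m' =>
    (∃ a < i, N.src a = m.nat 16 0 ∧ 0 < m.nat 5 a) → (m'.nat 13 0 < N.A ∧
      N.src (m'.nat 13 0) = m.nat 16 0 ∧ 0 < m.nat 5 (m'.nat 13 0))) rfl
    (by decide) (by decide) (by decide) hbA ?_ ?_ ?_).mono ?_
  · intro m' hF
    have := hl.of_frame hF
    simp [NExp.eval, numA, this.A]
  · simp
  · intro i hi m' hF h11 hI
    have hl' := hl.of_frame hF
    have e5 : m'.nat 5 = m.nat 5 := hF.2 5 (by decide)
    have e16 : m'.nat 16 = m.nat 16 := hF.2 16 (by decide)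
    have hb : (Test.and (.and (.nle (var 16) (.get 1 (var 11)))
      (.nle (.get 1 (var 11)) (var 16))) (.nle (.const 1) (.get 5 (var 11)))).Holds m' ↔
        N.src i = m.nat 16 0 ∧ 0 < m.nat 5 i := by
      simp only [Test.Holds, NExp.eval, var, h11, hl'.src, e5, e16]
      omega
    apply Runs.of_loopFree rfl
    rw [Program.run]
    simp only [Memory.setNat_nat_of_ne _ _ _ (show 13 ≠ 11 by decide)]
    by_cases h : N.src i = m.nat 16 0 ∧ 0 < m.nat 5 i
    · rw [if_pos (hb.2 h)]
      have : ((Program.set 13 (var 11)).run m').nat 13 0 = i := by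
        simp [Program.run, Program.set, Memory.setNat_nat, NExp.eval, var, h11]
      rw [this]
      exact fun _ => ⟨hi, h⟩
    · rw [if_neg fun h' => h (hb.1 h')]
      rintro ⟨a, ha, ha'⟩
      rcases Nat.lt_succ_iff_lt_or_eq.1 ha with ha | rfl
      · exact hI ⟨a, ha, ha'⟩
      · exact absurd ha' h
  · rintro m' ⟨hI, hF⟩
    exact ⟨hI hex, hF⟩

theorem move_run {N : Net} {m : Memory} (hl : Loaded N m) :
    (move.run m).nat 5 = Function.update (m.nat 5) (m.nat 13 0) (m.nat 5 (m.nat 13 0) - 1) ∧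
    (move.run m).nat 3 = Function.update (m.nat 3) (m.nat 17 0 * N.A + m.nat 13 0) 1 ∧
    (move.run m).nat 16 0 = N.tgt (m.nat 13 0) ∧ Frame [3, 5, 16] m (move.run m) := by
  refine ⟨?_, ?_, ?_, ⟨rfl, fun B hB => ?_⟩⟩
  · ext v
    simp [move, Program.run, Program.set, Memory.setNat_nat, NExp.eval, var,
      Function.update_apply]
  · ext v
    simp [move, Program.run, Program.set, Memory.setNat_nat, NExp.eval, var, numA, hl.A,
      Function.update_apply]
  · simp [move, Program.run, Program.set, Memory.setNat_nat, NExp.eval, var, hl.tgt]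
  · simp only [List.mem_cons, List.not_mem_nil, or_false, not_or] at hB
    simp only [move, Program.run, Program.set]
    rw [Memory.setNat_nat_of_ne _ _ _ hB.2.2, Memory.setNat_nat_of_ne _ _ _ hB.1,
      Memory.setNat_nat_of_ne _ _ _ hB.2.1]

theorem decompose_runs {b : ℕ} {N : Net} (hN : N.Valid) {m : Memory} (hl : Loaded N m)
    (hbA : N.A ≤ b) (hbn : N.n ≤ b) (hb : N.A * N.n ≤ b) (h3 : m.nat 3 = 0)
    (hf : N.Feasible (m.nat 5) (m.nat 6)) (hflow : N.IsFlow (m.nat 5) N.n)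
    (hfn : ∀ a < N.A, m.nat 5 a ≤ N.n) :
    Runs b decompose m fun m' => N.Decomp (m.nat 5) N.n (m'.nat 5) (m'.nat 3) := by
  refine (Runs.forLoop [3, 5, 11, 13, 16, 17] N.n
    (fun i m' => N.Decomp (m.nat 5) i (m'.nat 5) (m'.nat 3)) rfl
    (by decide) (by decide) (by decide) hbn ?_ ?_ ?_).mono fun m' h => h.1
  · intro m' hF
    have := hl.of_frame hF
    simp [NExp.eval, numN, this.n]
  · simp only [Memory.setNat_nat_of_ne _ _ _ (show 5 ≠ 17 by decide),
      Memory.setNat_nat_of_ne _ _ _ (show 3 ≠ 17 by decide), h3]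
    exact ⟨fun v => by rw [hflow v]; push_cast; ring, by simp, by simp, by simp⟩
  · intro i hi m' hF h17 hD
    have hl' := hl.of_frame hF
    simp only [Memory.setNat_nat_of_ne _ _ _ (show 5 ≠ 17 by decide),
      Memory.setNat_nat_of_ne _ _ _ (show 3 ≠ 17 by decide)]
    refine Runs.seq (Runs.of_loopFree rfl ?_)
    set m₁ := (Program.set 16 source).run m' with hm₁
    have hF₁ : Frame [3, 5, 11, 13, 16] m' m₁ :=
      ⟨rfl, fun B hB => Memory.setNat_nat_of_ne _ _ _ (by rintro rfl; simp at hB)⟩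
    have h16 : m₁.nat 16 0 = N.s := by
      simp [hm₁, Program.set, Program.run, NExp.eval, Memory.setNat_nat, source, hl'.s]
    have k5 : m₁.nat 5 = m'.nat 5 := Memory.setNat_nat_of_ne _ _ _ (by decide)
    have k3 : m₁.nat 3 = m'.nat 3 := Memory.setNat_nat_of_ne _ _ _ (by decide)
    -- Each iteration removes one unit of flow from an arc, so the total remaining arc flow, at most
    -- `A * n`, is a measure.
    refine (Runs.loop (fun m₂ =>
      N.DecompRow (m.nat 5) (m.nat 6) i (m₂.nat 5) (m₂.nat 3) (m₂.nat 16 0) ∧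
        Frame [3, 5, 11, 13, 16] m' m₂) (fun m₂ => ∑ a ∈ Finset.range N.A, m₂.nat 5 a)
      ?_ ⟨?_, hF₁⟩ ?_).mono ?_
    · rintro m₂ ⟨hR, hF₂⟩ hc
      have hl₂ := hl'.of_frame hF₂
      have hcur : m₂.nat 16 0 ≠ N.t := by
        intro h
        simp [Test.Holds, NExp.eval, sink, hl₂.t, var, h] at hc
      refine Runs.seq ((pick_runs hl₂ hbA (hR.exists_out hi hcur)).mono ?_)
      rintro m₃ ⟨⟨p1, p2, p3⟩, hF₃⟩
      have hl₃ := hl₂.of_frame hF₃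
      refine Runs.of_loopFree rfl ?_
      obtain ⟨r5, r3, r16, hF₄⟩ := move_run hl₃
      have e5 : m₃.nat 5 = m₂.nat 5 := hF₃.2 5 (by decide)
      have e3 : m₃.nat 3 = m₂.nat 3 := hF₃.2 3 (by decide)
      have e17 : m₃.nat 17 0 = i := by
        rw [hF₃.2 17 (by decide), hF₂.2 17 (by decide), h17]
      refine ⟨⟨?_, hF₂.trans ((hF₃.mono (by decide)).trans (hF₄.mono (by decide)))⟩, ?_⟩
      · rw [r5, r3, r16, e5, e3, e17]
        exact hR.step hN hf hfn p1 p2 p3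
      · rw [r5, e5]
        refine Finset.sum_lt_sum (fun a _ => ?_) ⟨_, Finset.mem_range.2 p1, ?_⟩
        · rw [Function.update_apply]
          split_ifs with h
          · subst h; omega
          · exact le_rfl
        · rw [Function.update_self]; omega
    · rw [k5, k3, h16]
      exact hD.row hN
    · refine le_trans ?_ hb
      rw [k5]
      refine (Finset.sum_le_card_nsmul _ _ N.n fun a ha => ?_).trans (by simp)
      rw [Finset.mem_range] at ha
      have := hD.sum a ha
      have := hfn a ha
      omega
    · rintro m₂ ⟨⟨hR, hF₂⟩, hc⟩
      have hl₂ := hl'.of_frame hF₂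
      have hcur : m₂.nat 16 0 = N.t := by
        simp [Test.Holds, NExp.eval, sink, hl₂.t, var] at hc
        omega
      rw [hcur] at hR
      exact hR.next

/-- Number of cells among the first `K` cells of real array `0` that hold a smaller value than the
cell `q`. -/
noncomputable def rank (m : Memory) (K q : ℕ) : ℕ :=
  open Classical in ((Finset.range K).filter fun r => m.real 0 r < m.real 0 q).card

/-- Ranks count table entries with multiplicity, so two nested loops of comparisons suffice and no
sorting is needed. -/
theorem weights_runs {b : ℕ} {m : Memory} {A n : ℕ} (hA : m.nat 0 1 = A) (hn : m.nat 0 2 = n)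
    (hb : A * (n + 1) ≤ b) :
    Runs b weights m fun m' =>
      (∀ q < A * (n + 1), m'.nat 4 q = (n * A + 1) ^ rank m (A * (n + 1)) q) ∧
        Frame [4, 11, 17] m m' := by
  have hK : ∀ m', Frame [4, 11, 17] m m' →
      (NExp.mul numA (.add numN (.const 1))).eval m' = A * (n + 1) := fun m' hF => by
    simp [NExp.eval, numA, numN, hF.2 0 (by decide), hA, hn]
  refine Runs.forLoop [4, 11, 17] (A * (n + 1)) (fun i m' => ∀ q < i,
    m'.nat 4 q = (n * A + 1) ^ rank m (A * (n + 1)) q) rfl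
    (by decide) (by decide) (by decide) hb hK (by simp) ?_
  intro i hi m' hF h17 hI
  refine Runs.seq (Runs.of_loopFree rfl ?_)
  set m₁ := (Program.nset 4 (var 17) (.const 1)).run m' with hm₁
  have hF₁ : Frame [4, 11] m' m₁ :=
    ⟨rfl, fun B hB => Memory.setNat_nat_of_ne _ _ _ (by rintro rfl; simp at hB)⟩
  have h4 : m₁.nat 4 = Function.update (m'.nat 4) i 1 := by
    rw [hm₁, Program.run, Memory.setNat_nat_self]
    simp [NExp.eval, var, h17]
  refine (Runs.forLoop [4, 11] (A * (n + 1)) (fun j m₂ => m₂.nat 4 =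
    Function.update (m'.nat 4) i ((n * A + 1) ^ rank m j i)) rfl
    (by decide) (by decide) (by decide) hb
    (fun m₂ hF₂ => hK m₂ ((hF.trans (hF₁.mono (by decide))).trans (hF₂.mono (by decide))))
    ?_ ?_).mono ?_
  · rw [Memory.setNat_nat_of_ne _ _ _ (by decide), h4]
    simp [rank]
  · intro j hj m₂ hF₂ h11 hI₂
    have hF' : Frame [4, 11, 17] m m₂ :=
      (hF.trans (hF₁.mono (by decide))).trans (hF₂.mono (by decide))
    have e17 : m₂.nat 17 0 = i := by
      rw [hF₂.2 17 (by decide), hF₁.2 17 (by decide), h17]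
    have e0 : m₂.nat 0 = m.nat 0 := hF'.2 0 (by decide)
    have hbt : (Test.not (.rle (.get 0 (var 17)) (.get 0 (var 11)))).Holds m₂ ↔
        m.real 0 j < m.real 0 i := by
      simp [Test.Holds, RExp.eval, NExp.eval, var, h11, e17, hF'.1]
    apply Runs.of_loopFree rfl
    rw [Program.run, Memory.setNat_nat_of_ne _ _ _ (by decide)]
    by_cases h : m.real 0 j < m.real 0 i
    · rw [if_pos (hbt.2 h), Program.run, Memory.setNat_nat_self, hI₂]
      have hr : rank m (j + 1) i = rank m j i + 1 := by
        simp only [rank, Finset.range_add_one]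
        rw [Finset.filter_insert, if_pos h, Finset.card_insert_of_notMem (by simp)]
      simp [NExp.eval, var, e17, hI₂, e0, numN, numA, hA, hn, hr, pow_succ]
    · rw [if_neg fun h' => h (hbt.1 h'), Program.run, hI₂]
      have hr : rank m (j + 1) i = rank m j i := by
        simp only [rank, Finset.range_add_one]
        rw [Finset.filter_insert, if_neg h]
      rw [hr]
  · rintro m₂ ⟨hI₂, hF₂⟩ q hq
    rw [Memory.setNat_nat_of_ne _ _ _ (by decide), hI₂]
    by_cases h : q = i
    · subst h; simp
    · rw [Function.update_of_ne h]
      exact hI q (by omega)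

end RealRAM

/-! ### Separated weights, improving moves and the potential. -/

namespace BottleneckRoutingGame

variable {G : BottleneckRoutingGame}

theorem numArcs_pos (G : BottleneckRoutingGame) : 0 < G.numArcs := by
  rcases Relation.ReflTransGen.cases_head G.reachable with h | ⟨_, ⟨a, _⟩, _⟩
  · exact absurd h G.source_ne_sink
  · exact a.pos

theorem load_le (x : G.Profile) (a : Fin G.numArcs) : G.load x a ≤ G.numPlayers :=
  (Finset.card_filter_le _ _).trans (by simp)

theorem mem_Icc {k : ℕ} (hk : k ≤ G.numPlayers) : (k : ℝ) ∈ Set.Icc (0 : ℝ) G.numPlayers :=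
  ⟨by positivity, by exact_mod_cast hk⟩

theorem cost_le_cost {k l : ℕ} (a : Fin G.numArcs) (hkl : k ≤ l) (hl : l ≤ G.numPlayers) :
    G.cost a k ≤ G.cost a l :=
  G.cost_mono a (mem_Icc (hkl.trans hl)) (mem_Icc hl) (by exact_mod_cast hkl)

/-! ### Weighted sums of the loads and their lexicographic comparison -/

/-- The sum of the arc flows, each weighted by a function of the cost of the arc. -/
noncomputable def weightedSum (G : BottleneckRoutingGame) (φ : ℝ → ℝ) (f : Fin G.numArcs → ℕ) : ℝ :=
  ∑ a, φ (G.cost a (f a)) * f a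

/-- The total flow on arcs of cost `v`. -/
noncomputable def level (G : BottleneckRoutingGame) (f : Fin G.numArcs → ℕ) (v : ℝ) : ℕ :=
  ∑ a, if G.cost a (f a) = v then f a else 0

/-- Weights for which larger arc costs dominate smaller ones. -/
structure Separated (G : BottleneckRoutingGame) (φ : ℝ → ℝ) : Prop where
  nonneg : ∀ (a : Fin G.numArcs) (k : ℕ), 1 ≤ k → k ≤ G.numPlayers → 0 ≤ φ (G.cost a k)
  lt : ∀ (a b : Fin G.numArcs) (k l : ℕ), 1 ≤ k → k ≤ G.numPlayers → 1 ≤ l → l ≤ G.numPlayers →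
    G.cost a k < G.cost b l → (G.numPlayers * G.numArcs : ℝ) * φ (G.cost a k) < φ (G.cost b l)

theorem exists_of_level_pos {f : Fin G.numArcs → ℕ} {v : ℝ} (h : 0 < G.level f v) :
    ∃ a, G.cost a (f a) = v ∧ 1 ≤ f a := by
  by_contra! hcon
  refine h.ne' (Finset.sum_eq_zero fun a _ => ?_)
  split_ifs with ha
  · have := hcon a ha; omega
  · rfl

/-- Grouping arcs by their cost; applied with `S` the set of attained costs, or those above a
threshold. -/
theorem sum_mul_level (φ : ℝ → ℝ) (f : Fin G.numArcs → ℕ) (S : Finset ℝ) :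
    ∑ v ∈ S, φ v * G.level f v =
      ∑ a, if G.cost a (f a) ∈ S then φ (G.cost a (f a)) * f a else 0 := by
  simp only [level, Nat.cast_sum, Finset.mul_sum]
  rw [Finset.sum_comm]
  refine Finset.sum_congr rfl fun a _ => ?_
  simp only [Nat.cast_ite, Nat.cast_zero, mul_ite, mul_zero]
  exact Finset.sum_ite_eq _ _ _

theorem weightedSum_congr (φ : ℝ → ℝ) {f g : Fin G.numArcs → ℕ}
    (h : ∀ v, G.level f v = G.level g v) : G.weightedSum φ f = G.weightedSum φ g := by
  classical
  set S : Finset ℝ := (Finset.univ.image fun a => G.cost a (f a)) ∪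
    Finset.univ.image fun a => G.cost a (g a) with hS
  have hf := sum_mul_level φ f S
  have hg := sum_mul_level φ g S
  have h1 : ∀ a, G.cost a (f a) ∈ S := fun a => by simp [hS]
  have h2 : ∀ a, G.cost a (g a) ∈ S := fun a => by simp [hS]
  simp only [h1, h2, if_true] at hf hg
  unfold weightedSum
  rw [← hf, ← hg]
  exact Finset.sum_congr rfl fun v _ => by rw [h v]

theorem weightedSum_split (φ : ℝ → ℝ) (f : Fin G.numArcs → ℕ) (K : ℝ) :
    G.weightedSum φ f = (∑ a, if K < G.cost a (f a) then φ (G.cost a (f a)) * f a else 0) +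
      φ K * G.level f K + ∑ a, if G.cost a (f a) < K then φ (G.cost a (f a)) * f a else 0 := by
  simp only [weightedSum, level, Nat.cast_sum, Finset.mul_sum]
  rw [← Finset.sum_add_distrib, ← Finset.sum_add_distrib]
  refine Finset.sum_congr rfl fun a _ => ?_
  rcases lt_trichotomy (G.cost a (f a)) K with h | h | h
  · simp [h, h.ne, h.not_gt]
  · simp [h]
  · simp [h, h.ne', h.not_gt]

/-- The sums agree above `K`, and at `K` the sum for `g` is larger by at least `φ K`. Below `K`, if
`φ K > 0`, each of the |A| arcs contributes less than `φ K / |A|` for `f`, so `f` cannot make up the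
difference. Strictness is conditional because `(v / C) ^ M` can vanish at cost zero. -/
theorem Separated.weightedSum_lt {φ : ℝ → ℝ} (hφ : G.Separated φ) {f g : Fin G.numArcs → ℕ}
    (hf : ∀ a, f a ≤ G.numPlayers) (hg : ∀ a, g a ≤ G.numPlayers) {K : ℝ}
    (hK : ∀ v, K < v → G.level f v = G.level g v) (hlt : G.level f K < G.level g K) :
    G.weightedSum φ f ≤ G.weightedSum φ g ∧
      (0 < φ K → G.weightedSum φ f < G.weightedSum φ g) := by
  classical
  have hA : (0 : ℝ) < G.numArcs := by exact_mod_cast G.numArcs_pos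
  have hn : (0 : ℝ) < G.numPlayers := by exact_mod_cast G.players_pos
  -- The level of `g` at `K` is positive, so `K` is an arc cost at a positive load and separation
  -- applies to it.
  obtain ⟨b, hb, hb1⟩ := exists_of_level_pos (Nat.zero_lt_of_lt hlt)
  have hφK : 0 ≤ φ K := hb ▸ hφ.nonneg b _ hb1 (hg b)
  rw [weightedSum_split φ f K, weightedSum_split φ g K]
  have hhigh : (∑ a, if K < G.cost a (f a) then φ (G.cost a (f a)) * f a else 0) =
      ∑ a, if K < G.cost a (g a) then φ (G.cost a (g a)) * g a else 0 := by
    set S : Finset ℝ := ((Finset.univ.image fun a => G.cost a (f a)) ∪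
      Finset.univ.image fun a => G.cost a (g a)).filter fun v => K < v with hS
    have hf' := sum_mul_level φ f S
    have hg' := sum_mul_level φ g S
    have h1 : ∀ a, G.cost a (f a) ∈ S ↔ K < G.cost a (f a) := fun a => by simp [hS]
    have h2 : ∀ a, G.cost a (g a) ∈ S ↔ K < G.cost a (g a) := fun a => by simp [hS]
    simp only [h1, h2] at hf' hg'
    rw [← hf', ← hg']
    refine Finset.sum_congr rfl fun v hv => ?_
    rw [hK v (Finset.mem_filter.1 hv).2]
  have hlow : 0 ≤ ∑ a, if G.cost a (g a) < K then φ (G.cost a (g a)) * g a else 0 := by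
    refine Finset.sum_nonneg fun a _ => ?_
    split_ifs with h
    · rcases Nat.eq_zero_or_pos (g a) with h0 | h0
      · simp [h0]
      · exact mul_nonneg (hφ.nonneg a _ h0 (hg a)) (by positivity)
    · exact le_rfl
  have hterm : ∀ a, ((G.numPlayers * G.numArcs : ℝ) *
      (if G.cost a (f a) < K then φ (G.cost a (f a)) * f a else 0) ≤ G.numPlayers * φ K) ∧
      (0 < φ K → (G.numPlayers * G.numArcs : ℝ) *
      (if G.cost a (f a) < K then φ (G.cost a (f a)) * f a else 0) < G.numPlayers * φ K) := by
    intro a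
    have hz : (0 : ℝ) ≤ G.numPlayers * φ K := by positivity
    by_cases h : G.cost a (f a) < K
    · rcases Nat.eq_zero_or_pos (f a) with h0 | h0
      · simpa [h0] using ⟨hz, fun h => by positivity⟩
      · have h1 := hφ.lt a b _ _ h0 (hf a) hb1 (hg b) (hb ▸ h)
        rw [hb] at h1
        have h2 : (0 : ℝ) < f a := by exact_mod_cast h0
        have h3 : (f a : ℝ) ≤ G.numPlayers := by exact_mod_cast hf a
        have h4 := mul_lt_mul_of_pos_right h1 h2
        have h5 := mul_le_mul_of_nonneg_left h3 hφK
        rw [if_pos h]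
        have h6 : (G.numPlayers * G.numArcs : ℝ) * (φ (G.cost a (f a)) * f a) <
          G.numPlayers * φ K := by linarith
        exact ⟨h6.le, fun _ => h6⟩
    · simpa [h] using ⟨hz, fun h => by positivity⟩
  have hne : (Finset.univ : Finset (Fin G.numArcs)).Nonempty := ⟨b, Finset.mem_univ b⟩
  have hconst : ∑ _a : Fin G.numArcs, (G.numPlayers * φ K : ℝ) =
      (G.numPlayers * G.numArcs : ℝ) * φ K := by
    simp; ring
  have hpos : (0 : ℝ) < G.numPlayers * G.numArcs := by positivity
  have hlevel : φ K * G.level f K + φ K ≤ φ K * G.level g K := by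
    have : (G.level f K : ℝ) + 1 ≤ G.level g K := by exact_mod_cast hlt
    nlinarith
  constructor
  · have h1 := Finset.sum_le_sum fun a (_ : a ∈ Finset.univ) => (hterm a).1
    rw [← Finset.mul_sum, hconst] at h1
    have h2 := le_of_mul_le_mul_left h1 hpos
    rw [hhigh]
    linarith
  · intro h0
    have h1 := Finset.sum_lt_sum_of_nonempty hne fun a _ => (hterm a).2 h0
    rw [← Finset.mul_sum, hconst] at h1
    have h2 := lt_of_mul_lt_mul_left h1 hpos.le
    rw [hhigh]
    linarith

/-- All separated weights induce the same order, up to ties caused by zero weights. -/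
theorem Separated.weightedSum_le {φ ψ : ℝ → ℝ} (hφ : G.Separated φ) (hψ : G.Separated ψ)
    (hpos : ∀ v, 0 < φ v) {f g : Fin G.numArcs → ℕ} (hf : ∀ a, f a ≤ G.numPlayers)
    (hg : ∀ a, g a ≤ G.numPlayers) (h : G.weightedSum φ f ≤ G.weightedSum φ g) :
    G.weightedSum ψ f ≤ G.weightedSum ψ g := by
  classical
  by_cases heq : ∀ v, G.level f v = G.level g v
  · exact (weightedSum_congr ψ heq).le
  -- The comparison is decided at the largest cost where the levels differ. Positivity of `φ`
  -- excludes that `f` has the larger level there.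
  · set D : Finset ℝ := ((Finset.univ.image fun a => G.cost a (f a)) ∪
      Finset.univ.image fun a => G.cost a (g a)).filter fun v => G.level f v ≠ G.level g v with hD
    have hmem : ∀ v, G.level f v ≠ G.level g v → v ∈ D := by
      intro v hv
      refine Finset.mem_filter.2 ⟨?_, hv⟩
      rcases Nat.eq_zero_or_pos (G.level f v) with h0 | h0
      · obtain ⟨a, ha, -⟩ := exists_of_level_pos (f := g) (v := v) (by omega)
        exact Finset.mem_union_right _ (Finset.mem_image.2 ⟨a, Finset.mem_univ a, ha⟩)
      · obtain ⟨a, ha, -⟩ := exists_of_level_pos h0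
        exact Finset.mem_union_left _ (Finset.mem_image.2 ⟨a, Finset.mem_univ a, ha⟩)
    push Not at heq
    obtain ⟨v, hv⟩ := heq
    have hne : D.Nonempty := ⟨v, hmem v hv⟩
    have hmax : ∀ v, D.max' hne < v → G.level f v = G.level g v := fun v hv => by
      by_contra hcon
      exact absurd (D.le_max' v (hmem v hcon)) (not_le.2 hv)
    rcases lt_or_gt_of_ne (Finset.mem_filter.1 (D.max'_mem hne)).2 with hlt | hlt
    · exact (hψ.weightedSum_lt hf hg hmax hlt).1
    · exact absurd ((hφ.weightedSum_lt hg hf (fun v hv => (hmax v hv).symm) hlt).2 (hpos _))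
        (not_lt.2 h)

/-- Improving moves decrease the weighted sum of the loads. -/
theorem Separated.improving {φ : ℝ → ℝ} (hφ : G.Separated φ) (hpos : ∀ v, 0 < v → 0 < φ v)
    {S : Finset (Fin G.numPlayers)} {x z : G.Profile} (h : IsImprovingMove G.privateCost S x z) :
    G.weightedSum φ (G.load z) < G.weightedSum φ (G.load x) := by
  classical
  obtain ⟨hS, hout, himp⟩ := h
  -- Before the move no member of the coalition uses an arc of cost above `K`, the private cost of
  -- `i₀`; after it, none uses an arc of cost `K` or more.
  obtain ⟨i₀, hi₀, hi₀max⟩ := S.exists_max_image (G.privateCost x) hS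
  have hcost : ∀ (y : G.Profile) i a, a ∈ (y i).1 → G.cost a (G.load y a) ≤ G.privateCost y i :=
    fun y i a ha => Finset.le_sup' (fun a => G.cost a (G.load y a)) ha
  have hnonneg : ∀ y i, 0 ≤ G.privateCost y i := fun y i => by
    obtain ⟨a, ha⟩ := (y i).arcs_nonempty
    exact (G.cost_nonneg a _ (mem_Icc (load_le y a))).trans (hcost y i a ha)
  set K := G.privateCost x i₀ with hKdef
  have hz : ∀ a, K ≤ G.cost a (G.load z a) → ∀ i, a ∈ (z i).1 → i ∉ S := fun a ha i hai hiS =>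
    absurd (ha.trans (hcost z i a hai)) (not_le.2 ((himp i hiS).trans_le (hi₀max i hiS)))
  have hzle : ∀ a, K ≤ G.cost a (G.load z a) → G.load z a ≤ G.load x a := fun a ha =>
    Finset.card_le_card fun i hi => by
      simp only [Finset.mem_filter, Finset.mem_univ, true_and] at hi ⊢
      rw [← hout i (hz a ha i hi)]; exact hi
  have hxle : ∀ a, K < G.cost a (G.load x a) → G.load x a ≤ G.load z a := fun a ha =>
    Finset.card_le_card fun i hi => by
      simp only [Finset.mem_filter, Finset.mem_univ, true_and] at hi ⊢
      rw [hout i fun hiS => absurd (ha.trans_le (hcost x i a hi)) (not_lt.2 (hi₀max i hiS))]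
      exact hi
  have heqz : ∀ a, K < G.cost a (G.load z a) → G.load z a = G.load x a := fun a ha =>
    le_antisymm (hzle a ha.le)
      (hxle a (ha.trans_le (cost_le_cost a (hzle a ha.le) (load_le x a))))
  have heqx : ∀ a, K < G.cost a (G.load x a) → G.load z a = G.load x a := fun a ha =>
    heqz a (ha.trans_le (cost_le_cost a (hxle a ha) (load_le z a)))
  have hxK : ∀ a, G.cost a (G.load z a) = K → G.cost a (G.load x a) = K := fun a ha => by
    refine le_antisymm (not_lt.1 fun h => ?_)
      (ha ▸ cost_le_cost a (hzle a ha.ge) (load_le x a))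
    have := heqx a h
    rw [← this, ha] at h
    exact lt_irrefl _ h
  -- Positivity of `K`: the new private cost of `i₀` is non-negative and smaller than `K`.
  refine (hφ.weightedSum_lt (load_le z) (load_le x) (K := K) (fun v hv => ?_) ?_).2
    (hpos K ((hnonneg z i₀).trans_lt (himp i₀ hi₀)))
  · refine Finset.sum_congr rfl fun a _ => ?_
    by_cases h1 : G.cost a (G.load z a) = v
    · rw [← heqz a (h1 ▸ hv)]
    · by_cases h2 : G.cost a (G.load x a) = v
      · rw [heqx a (h2 ▸ hv)]
      · simp [h1, h2]
  -- A bottleneck arc of `i₀` makes the level at `K` drop strictly: its cost changes, or it stays at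
  -- `K` and loses the user `i₀` without gaining any.
  · obtain ⟨a, ha, hamax⟩ := Finset.exists_mem_eq_sup' (x i₀).arcs_nonempty
      fun a => G.cost a (G.load x a)
    have haK : G.cost a (G.load x a) = K := hamax.symm
    refine Finset.sum_lt_sum (fun b _ => ?_) ⟨a, Finset.mem_univ a, ?_⟩
    · by_cases hb : G.cost b (G.load z b) = K
      · rw [if_pos hb, if_pos (hxK b hb)]
        exact hzle b hb.ge
      · rw [if_neg hb]; exact Nat.zero_le _
    · rw [if_pos haK]
      by_cases hb : G.cost a (G.load z a) = K
      · rw [if_pos hb]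
        refine Finset.card_lt_card (Finset.ssubset_iff_of_subset (fun i hi => ?_) |>.2
          ⟨i₀, by simpa using ha, fun hi => ?_⟩)
        · simp only [Finset.mem_filter, Finset.mem_univ, true_and] at hi ⊢
          rw [← hout i (hz a hb.ge i hi)]; exact hi
        · simp only [Finset.mem_filter, Finset.mem_univ, true_and] at hi
          exact hz a hb.ge i₀ hi hi₀
      · rw [if_neg hb]
        exact Finset.card_pos.2 ⟨i₀, by simpa using ha⟩

/-! ### The potential -/

/-- For costs u < v, the gap and v ≤ C give u ≤ v - δ ≤ v(1 - δ/C) ≤ v·exp(-δ/C). Taking the M-th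
power gains the factor exp(-δM/C), which is below 1/(n|A|) by the choice of M. -/
theorem separated_pow {C M : ℕ} {δ : ℝ} (hC : 0 < C) (hb : G.CostsBoundedBy C) (hδ : 0 < δ)
    (hgap : G.CostGap δ) (hM : Real.log (G.numPlayers * G.numArcs) * (C / δ) < M) :
    G.Separated fun v => (v / C) ^ M := by
  have hC' : (0 : ℝ) < C := by exact_mod_cast hC
  have hn : (0 : ℝ) < G.numPlayers := by exact_mod_cast G.players_pos
  have hA : (0 : ℝ) < G.numArcs := by exact_mod_cast G.numArcs_pos
  refine ⟨fun a k _ hk => pow_nonneg (div_nonneg (G.cost_nonneg a _ (mem_Icc hk)) hC'.le) M, ?_⟩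
  intro a b k l hk1 hk hl1 hl hlt
  have hu : 0 ≤ G.cost a k := G.cost_nonneg a _ (mem_Icc hk)
  have hv : G.cost b l ≤ C := hb b _ (mem_Icc hl)
  have hd : G.cost a k ≤ G.cost b l - δ := by
    have := hgap a b k l hk1 hk hl1 hl hlt.ne
    rw [abs_sub_comm, abs_of_pos (sub_pos.2 hlt)] at this
    linarith
  generalize G.cost a k = u at *
  generalize G.cost b l = v at *
  have hvpos : 0 < v := by linarith
  have h1 : u / C ≤ v / C * Real.exp (-(δ / C)) := by
    rw [div_mul_eq_mul_div]
    refine div_le_div_of_nonneg_right ?_ hC'.le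
    have h2 : 1 - δ / C ≤ Real.exp (-(δ / C)) := by
      have := Real.add_one_le_exp (-(δ / C)); linarith
    have h3 : δ / C * v ≤ δ := by
      rw [div_mul_eq_mul_div, div_le_iff₀ hC']
      exact mul_le_mul_of_nonneg_left hv hδ.le
    have h4 := mul_le_mul_of_nonneg_left h2 hvpos.le
    nlinarith
  have h2 : (u / C) ^ M ≤ (v / C) ^ M * Real.exp (-(δ / C) * M) := by
    refine (pow_le_pow_left₀ (by positivity) h1 M).trans (le_of_eq ?_)
    rw [mul_pow, ← Real.exp_nat_mul, mul_comm (M : ℝ)]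
  have h3 : (G.numPlayers * G.numArcs : ℝ) * Real.exp (-(δ / C) * M) < 1 := by
    rw [← Real.exp_log (show (0 : ℝ) < G.numPlayers * G.numArcs by positivity), ← Real.exp_add,
      Real.exp_lt_one_iff]
    have h4 : Real.log (G.numPlayers * G.numArcs) < δ / C * M := by
      have := mul_lt_mul_of_pos_right hM (div_pos hδ hC')
      rw [mul_assoc, div_mul_div_comm, mul_comm (C : ℝ) δ, div_self (by positivity), mul_one] at this
      linarith
    linarith
  have h4 : 0 < (v / C) ^ M := by positivity
  calc (G.numPlayers * G.numArcs : ℝ) * (u / C) ^ M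
      ≤ (G.numPlayers * G.numArcs : ℝ) * ((v / C) ^ M * Real.exp (-(δ / C) * M)) :=
        mul_le_mul_of_nonneg_left h2 (by positivity)
    _ = (v / C) ^ M * ((G.numPlayers * G.numArcs : ℝ) * Real.exp (-(δ / C) * M)) := by ring
    _ < (v / C) ^ M * 1 := mul_lt_mul_of_pos_left h3 h4
    _ = (v / C) ^ M := mul_one _

/-- Powers and products of non-negative, non-decreasing convex functions are convex. -/
theorem convexOn_arcPotential (hconv : G.ConvexCosts) (C M : ℕ) (a : Fin G.numArcs) :
    ConvexOn ℝ (Set.Icc (0 : ℝ) G.numPlayers) (G.arcPotential C M a) := by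
  have h0 : ∀ ⦃y⦄, y ∈ Set.Icc (0 : ℝ) G.numPlayers → 0 ≤ G.cost a y / C := fun y hy =>
    div_nonneg (G.cost_nonneg a y hy) (by positivity)
  have h1 : ConvexOn ℝ (Set.Icc (0 : ℝ) G.numPlayers) fun y => G.cost a y / C := by
    have := (hconv a).smul (c := (C : ℝ)⁻¹) (by positivity)
    simpa only [smul_eq_mul, inv_mul_eq_div] using this
  have hmono : MonotoneOn (fun y => (G.cost a y / C) ^ M) (Set.Icc (0 : ℝ) G.numPlayers) :=
    fun y hy z hz hyz => pow_le_pow_left₀ (h0 hy)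
      (div_le_div_of_nonneg_right (G.cost_mono a hy hz hyz) (by positivity)) M
  exact (h1.pow h0 M).mul (convexOn_id (convex_Icc _ _)) (fun y hy => pow_nonneg (h0 hy) M)
    (fun y hy => hy.1) (hmono.monovaryOn monotoneOn_id)

theorem isGenStrongOrdinalPotential {C M : ℕ} {δ : ℝ} (hC : 0 < C) (hb : G.CostsBoundedBy C)
    (hδ : 0 < δ) (hgap : G.CostGap δ)
    (hM : Real.log (G.numPlayers * G.numArcs) * (C / δ) < M) :
    IsGenStrongOrdinalPotential G.privateCost fun y => G.potential C M (G.load y) :=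
  fun _ _ _ h => (separated_pow hC hb hδ hgap hM).improving
    (fun v hv => pow_pos (div_pos hv (by exact_mod_cast hC)) M) h

/-! ### Loads are flows -/

theorem sum_walk {u v : Fin G.numVertices} {l : List (Fin G.numArcs)} (h : G.IsWalk u l v)
    (w : Fin G.numVertices) :
    (l.map fun a => (if G.src a = w then (1 : ℤ) else 0) - if G.tgt a = w then 1 else 0).sum =
      (if u = w then 1 else 0) - if v = w then 1 else 0 := by
  induction l generalizing u with
  | nil => cases h; simp
  | cons a l ih =>
    obtain ⟨rfl, h⟩ := h
    rw [List.map_cons, List.sum_cons, ih h]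
    ring

theorem isIntegralFlow_load (x : G.Profile) : G.IsIntegralFlow (G.load x) := by
  classical
  refine ⟨load_le x, fun v => ?_⟩
  have hpath : ∀ P : G.Strategy, ∑ a ∈ P.1,
      ((if G.src a = v then (1 : ℤ) else 0) - if G.tgt a = v then 1 else 0) =
      (if G.s = v then 1 else 0) - if G.t = v then 1 else 0 := by
    rintro ⟨P, l, hw, hnd, rfl⟩
    -- The heads along the path are distinct, hence so are its arcs, and the sum over the arc set is
    -- the telescoping sum along the walk.
    rw [← sum_walk hw v, List.sum_toFinset _ ((List.nodup_cons.1 hnd).2.of_map _)]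
  have hload : ∀ a, (G.load x a : ℤ) = ∑ i, if a ∈ (x i).1 then (1 : ℤ) else 0 := fun a => by
    simp [load]
  have h1 : (∑ a with G.src a = v, (G.load x a : ℤ)) - ∑ a with G.tgt a = v, (G.load x a : ℤ) =
      ∑ a, (G.load x a : ℤ) *
        ((if G.src a = v then (1 : ℤ) else 0) - if G.tgt a = v then 1 else 0) := by
    simp only [mul_sub, mul_ite, mul_one, mul_zero, Finset.sum_sub_distrib, Finset.sum_filter]
  rw [h1]
  simp_rw [hload, Finset.sum_mul]
  rw [Finset.sum_comm]
  have h2 : ∀ i, ∑ a, (if a ∈ (x i).1 then (1 : ℤ) else 0) *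
      ((if G.src a = v then (1 : ℤ) else 0) - if G.tgt a = v then 1 else 0) =
      (if G.s = v then 1 else 0) - if G.t = v then 1 else 0 := fun i => by
    rw [← hpath (x i)]
    simp only [ite_mul, one_mul, zero_mul]
    rw [Finset.sum_ite_mem, Finset.univ_inter]
  rw [Finset.sum_congr rfl fun i _ => h2 i]
  rw [Finset.sum_const, Finset.card_univ, Fintype.card_fin, nsmul_eq_mul]
  by_cases hs : v = G.s
  · subst hs
    simp [G.source_ne_sink.symm]
  · by_cases ht : v = G.t
    · subst ht
      simp [hs, Ne.symm hs]
    · simp [hs, ht, Ne.symm hs, Ne.symm ht]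

end BottleneckRoutingGame

/-! ### From the game to its network and back. -/

namespace BottleneckRoutingGame

variable {G : BottleneckRoutingGame}

/-! ### The network of a game -/

/-- The cost table, as it is stored in memory. -/
noncomputable def table (G : BottleneckRoutingGame) : ℕ → ℝ := (G.input 0).real 0

theorem table_apply (a : Fin G.numArcs) {k : ℕ} (hk : k ≤ G.numPlayers) :
    G.table (a * (G.numPlayers + 1) + k) = G.cost a k := by
  have h1 : ((a : ℕ) * (G.numPlayers + 1) + k) / (G.numPlayers + 1) = a := by
    rw [mul_comm, Nat.mul_add_div (Nat.succ_pos _), Nat.div_eq_of_lt (by omega), add_zero]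
  have h2 : ((a : ℕ) * (G.numPlayers + 1) + k) % (G.numPlayers + 1) = k := by
    rw [mul_comm, Nat.mul_add_mod, Nat.mod_eq_of_lt (by omega)]
  simp [table, input, h1, h2]

theorem table_index_lt (a : Fin G.numArcs) {k : ℕ} (hk : k ≤ G.numPlayers) :
    a * (G.numPlayers + 1) + k < G.numArcs * (G.numPlayers + 1) := by
  have h1 : ((a : ℕ) + 1) * (G.numPlayers + 1) ≤ G.numArcs * (G.numPlayers + 1) :=
    Nat.mul_le_mul_right _ a.2
  rw [Nat.succ_mul] at h1
  omega

open Classical in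
/-- The weight `B ^ r` of a cost, where `r` is its rank among the entries of the cost table. -/
noncomputable def factor (G : BottleneckRoutingGame) (v : ℝ) : ℕ :=
  (G.numPlayers * G.numArcs + 1) ^
    ((Finset.range (G.numArcs * (G.numPlayers + 1))).filter fun r => G.table r < v).card

theorem factor_pos (v : ℝ) : 0 < G.factor v := by unfold factor; positivity

theorem factor_mono {u v : ℝ} (h : u ≤ v) : G.factor u ≤ G.factor v :=
  Nat.pow_le_pow_right (Nat.succ_pos _) (Finset.card_le_card
    (Finset.monotone_filter_right _ fun _ _ hr => lt_of_lt_of_le hr h))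

/-- The table cell of `c_a(k)` itself is counted in the rank of `v` but not in that of `c_a(k)`, so
the rank grows by at least one. -/
theorem factor_lt (a : Fin G.numArcs) {k : ℕ} (hk : k ≤ G.numPlayers) {v : ℝ}
    (h : G.cost a k < v) :
    (G.numPlayers * G.numArcs + 1) * G.factor (G.cost a k) ≤ G.factor v := by
  classical
  unfold factor
  rw [← pow_succ']
  refine Nat.pow_le_pow_right (Nat.succ_pos _) (Finset.card_lt_card ?_)
  refine (Finset.ssubset_iff_of_subset (Finset.monotone_filter_right _ fun _ _ hr =>
    lt_trans hr h)).2 ⟨a * (G.numPlayers + 1) + k, ?_, ?_⟩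
  · simp only [Finset.mem_filter, Finset.mem_range]
    exact ⟨table_index_lt a hk, by rwa [table_apply a hk]⟩
  · simp [table_apply a hk]

theorem separated_factor (G : BottleneckRoutingGame) : G.Separated fun v => (G.factor v : ℝ) := by
  refine ⟨fun _ _ _ _ => by positivity, fun a b k l _ hk _ _ hlt => ?_⟩
  have h1 := factor_lt a hk hlt
  have h2 := factor_pos (G := G) (G.cost a k)
  have : G.numPlayers * G.numArcs * G.factor (G.cost a k) < G.factor (G.cost b l) := by
    rw [Nat.succ_mul] at h1; omega
  exact_mod_cast this

/-- The network of a game, for given contents of the array of weights. -/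
noncomputable def net (G : BottleneckRoutingGame) (C : ℕ) (E : ℕ → ℕ) : Net where
  V := G.numVertices
  A := G.numArcs
  n := G.numPlayers
  s := G.s
  t := G.t
  src := (G.input C).nat 1
  tgt := (G.input C).nat 2
  E := E

theorem net_src (C : ℕ) (E : ℕ → ℕ) (a : Fin G.numArcs) : (G.net C E).src a = G.src a := by
  simp [net, input]

theorem net_tgt (C : ℕ) (E : ℕ → ℕ) (a : Fin G.numArcs) : (G.net C E).tgt a = G.tgt a := by
  simp [net, input]

/-- The array holds the weights of the costs in the cost table. -/
def IsWeight (G : BottleneckRoutingGame) (E : ℕ → ℕ) : Prop :=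
  ∀ (a : Fin G.numArcs) (k : ℕ), k ≤ G.numPlayers →
    E (a * (G.numPlayers + 1) + k) = G.factor (G.cost a k)

theorem IsWeight.w_eq {C : ℕ} {E : ℕ → ℕ} (hE : G.IsWeight E) (a : Fin G.numArcs) {k : ℕ}
    (hk : k ≤ G.numPlayers) : (G.net C E).w a k = k * G.factor (G.cost a k) := by
  rw [Net.w, ← hE a k hk]; rfl

/-- For `w_convex`: if the cost rises from load `k + 1` to `k + 2`, its weight at least doubles,
which is enough. Otherwise convexity and monotonicity make the cost constant on `k`, `k + 1`, `k +
2`, and `w` is linear there. -/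
theorem IsWeight.valid {C : ℕ} {E : ℕ → ℕ} (hE : G.IsWeight E) (hconv : G.ConvexCosts) :
    (G.net C E).Valid where
  s_lt := G.s.2
  t_lt := G.t.2
  s_ne_t := fun h => G.source_ne_sink (Fin.ext h)
  src_lt a ha := by
    have := net_src C E (⟨a, ha⟩ : Fin G.numArcs)
    rw [this]; exact Fin.is_lt _
  tgt_lt a ha := by
    have := net_tgt C E (⟨a, ha⟩ : Fin G.numArcs)
    rw [this]; exact Fin.is_lt _
  reach R hs hR := by
    have key : ∀ v, Relation.ReflTransGen (fun u v => ∃ a, G.src a = u ∧ G.tgt a = v) G.s v →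
        R v := fun v hv => by
      induction hv with
      | refl => exact hs
      | tail _ h ih =>
        obtain ⟨a, rfl, rfl⟩ := h
        rw [← net_tgt C E a]
        exact hR a a.2 (by rw [net_src]; exact ih)
    exact key _ G.reachable
  w_lt a ha k hk := by
    change k < G.numPlayers at hk
    have h1 := hE.w_eq (C := C) ⟨a, ha⟩ (k := k) hk.le
    have h2 := hE.w_eq (C := C) ⟨a, ha⟩ (k := k + 1) hk
    simp only at h1 h2
    rw [h1, h2]
    have h3 := factor_mono (G := G) (cost_le_cost (G := G) ⟨a, ha⟩ (Nat.le_succ k) hk)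
    have h4 := factor_pos (G := G) (G.cost ⟨a, ha⟩ (k + 1 : ℕ))
    exact (Nat.mul_le_mul_left k h3).trans_lt (Nat.mul_lt_mul_of_pos_right (Nat.lt_succ_self k) h4)
  w_convex a ha k hk := by
    change k + 2 ≤ G.numPlayers at hk
    have h1 := hE.w_eq (C := C) ⟨a, ha⟩ (k := k) (by omega)
    have h2 := hE.w_eq (C := C) ⟨a, ha⟩ (k := k + 1) (by omega)
    have h3 := hE.w_eq (C := C) ⟨a, ha⟩ (k := k + 2) hk
    simp only at h1 h2 h3
    rw [h1, h2, h3]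
    have hA := G.numArcs_pos
    have hn := G.players_pos
    -- Makes the base `n|A| + 1` at least 2.
    have hB : 1 ≤ G.numPlayers * G.numArcs := Nat.mul_pos hn hA
    rcases (cost_le_cost (G := G) ⟨a, ha⟩ (Nat.le_succ (k + 1)) hk).lt_or_eq with hlt | heq
    · have h4 := factor_lt (G := G) ⟨a, ha⟩ (by omega) hlt
      have h5 : 2 * G.factor (G.cost ⟨a, ha⟩ (k + 1 : ℕ)) ≤
          G.factor (G.cost ⟨a, ha⟩ (k + 2 : ℕ)) :=
        (Nat.mul_le_mul_right _ (by omega)).trans h4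
      have h6 := Nat.mul_le_mul (show k + 1 ≤ k + 2 by omega) h5
      calc 2 * ((k + 1) * G.factor (G.cost ⟨a, ha⟩ (k + 1 : ℕ)))
          = (k + 1) * (2 * G.factor (G.cost ⟨a, ha⟩ (k + 1 : ℕ))) := by ring
        _ ≤ _ := h6.trans (Nat.le_add_left _ _)
    · have heq' : G.cost ⟨a, ha⟩ (k + 1 : ℕ) = G.cost ⟨a, ha⟩ (k + 2 : ℕ) := heq
      have hk0 : G.cost ⟨a, ha⟩ (k : ℕ) = G.cost ⟨a, ha⟩ (k + 1 : ℕ) := by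
        refine le_antisymm (cost_le_cost _ (Nat.le_succ k) (by omega)) ?_
        -- Midpoint convexity together with equal costs at `k + 1` and `k + 2`.
        have hc := (hconv ⟨a, ha⟩).2 (mem_Icc (show k ≤ G.numPlayers by omega)) (mem_Icc hk)
          (show (0 : ℝ) ≤ 1 / 2 by norm_num) (show (0 : ℝ) ≤ 1 / 2 by norm_num) (by norm_num)
        have hmid : (1 / 2 : ℝ) • (k : ℝ) + (1 / 2 : ℝ) • ((k + 2 : ℕ) : ℝ) = ((k + 1 : ℕ) : ℝ) := by
          simp only [smul_eq_mul]; push_cast; ring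
        rw [hmid, ← heq'] at hc
        simp only [smul_eq_mul] at hc
        linarith
      rw [hk0, heq']
      apply le_of_eq
      ring

/-- An arc flow of the game as an arc flow of its network. -/
def extend (f : Fin G.numArcs → ℕ) (a : ℕ) : ℕ := if h : a < G.numArcs then f ⟨a, h⟩ else 0

theorem extend_apply (f : Fin G.numArcs → ℕ) (a : Fin G.numArcs) : extend f a = f a := by
  simp [extend]

theorem IsIntegralFlow.isFlow {f : Fin G.numArcs → ℕ} (hf : G.IsIntegralFlow f) (C : ℕ)
    (E : ℕ → ℕ) : (G.net C E).IsFlow (extend f) G.numPlayers := by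
  intro v
  have h1 : (G.net C E).div (extend f) v = ∑ a : Fin G.numArcs, (f a : ℤ) *
      ((if (G.src a : ℕ) = v then 1 else 0) - (if (G.tgt a : ℕ) = v then 1 else 0)) := by
    unfold Net.div
    change ∑ a ∈ Finset.range G.numArcs, _ = _
    rw [Finset.sum_range]
    exact Finset.sum_congr rfl fun a _ => by rw [extend_apply, net_src, net_tgt]
  rw [h1]
  change _ = (G.numPlayers : ℤ) *
    ((if (G.s : ℕ) = v then 1 else 0) - (if (G.t : ℕ) = v then 1 else 0))
  by_cases hv : v < G.numVertices
  · have h2 := hf.2 ⟨v, hv⟩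
    have h3 : ∀ u : Fin G.numVertices, (u : ℕ) = v ↔ u = ⟨v, hv⟩ := fun u => by
      rw [Fin.ext_iff]
    simp only [h3]
    simp only [Finset.sum_filter] at h2
    simp only [mul_sub, mul_ite, mul_one, mul_zero, Finset.sum_sub_distrib]
    rw [h2]
    by_cases hs : (⟨v, hv⟩ : Fin G.numVertices) = G.s
    · rw [hs]; simp [G.source_ne_sink.symm]
    · by_cases ht : (⟨v, hv⟩ : Fin G.numVertices) = G.t
      · rw [ht]; simp [G.source_ne_sink.symm, G.source_ne_sink]
      · simp [hs, ht, Ne.symm hs, Ne.symm ht]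
  -- `IsFlow` quantifies over all natural numbers; at those that are no vertices both sides vanish.
  · have h3 : ∀ u : Fin G.numVertices, (u : ℕ) ≠ v := fun u h => hv (h ▸ u.2)
    simp [h3]

theorem IsWeight.sum_w {C : ℕ} {E : ℕ → ℕ} (hE : G.IsWeight E) {f : Fin G.numArcs → ℕ}
    (hf : ∀ a, f a ≤ G.numPlayers) :
    ((∑ a ∈ Finset.range (G.net C E).A, (G.net C E).w a (extend f a) : ℕ) : ℝ) =
      G.weightedSum (fun v => (G.factor v : ℝ)) f := by
  change ((∑ a ∈ Finset.range G.numArcs, _ : ℕ) : ℝ) = _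
  rw [Finset.sum_range, Nat.cast_sum]
  refine Finset.sum_congr rfl fun a _ => ?_
  rw [extend_apply, hE.w_eq a (hf a)]
  push_cast
  ring

/-! ### Routes of the network are strategies -/

theorem isPath_of_route {C : ℕ} {E : ℕ → ℕ} {l : List ℕ}
    (h : (G.net C E).Route l (G.net C E).t) :
    ∃ P : G.Strategy, ∀ a : Fin G.numArcs, a ∈ P.1 ↔ (a : ℕ) ∈ l := by
  obtain ⟨hw, hnd, hlt⟩ := h
  change ∀ a ∈ l, a < G.numArcs at hlt
  obtain ⟨l', rfl⟩ : ∃ l' : List (Fin G.numArcs), l'.map Fin.val = l :=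
    ⟨l.pmap Fin.mk hlt, by simp [List.map_pmap]⟩
  refine ⟨⟨l'.toFinset, l', ?_, ?_, rfl⟩, fun a => ?_⟩
  · have key : ∀ (l' : List (Fin G.numArcs)) (u : Fin G.numVertices),
        (G.net C E).IsWalk u (l'.map Fin.val) G.t → G.IsWalk u l' G.t := by
      intro l'
      induction l' with
      | nil => exact fun u h => Fin.ext h
      | cons a l' ih =>
        rintro u ⟨h1, h2⟩
        rw [net_src] at h1
        rw [net_tgt] at h2
        exact ⟨Fin.ext h1, ih _ h2⟩
    exact key l' G.s hw
  · refine List.Nodup.of_map Fin.val ?_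
    have : (G.s :: l'.map G.tgt).map Fin.val =
        (G.net C E).s :: (l'.map Fin.val).map (G.net C E).tgt := by
      simp only [List.map_cons, List.map_map]
      congr 1
      exact List.map_congr_left fun a _ => (net_tgt C E a).symm
    rw [this]
    exact hnd
  · rw [List.mem_toFinset, List.mem_map_of_injective Fin.val_injective]

/-- Correctness of the path decomposition in terms of the game. -/
theorem exists_profile {C : ℕ} {E f π g out : ℕ → ℕ} (hN : (G.net C E).Valid)
    (hf : (G.net C E).Feasible f π) (hfn : ∀ a < G.numArcs, f a ≤ G.numPlayers)
    (h : (G.net C E).Decomp f G.numPlayers g out) :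
    ∃ x : G.Profile, (∀ (i : Fin G.numPlayers) (a : Fin G.numArcs),
      out (i * G.numArcs + a) = if a ∈ (x i).1 then 1 else 0) ∧ ∀ a, G.load x a = f a := by
  classical
  have h1 : ∀ i : Fin G.numPlayers, ∃ P : G.Strategy, ∀ a : Fin G.numArcs,
      out (i * G.numArcs + a) = if a ∈ P.1 then 1 else 0 := fun i => by
    obtain ⟨l, hl, hout⟩ := h.routes i i.2
    obtain ⟨P, hP⟩ := isPath_of_route hl
    refine ⟨P, fun a => ?_⟩
    simp only [hP]
    exact hout a a.2
  choose x hx using h1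
  refine ⟨x, fun i a => ?_, fun a => ?_⟩
  · exact hx i a
  · have h2 := h.sum_eq hN hf hfn a.2
    rw [← h2]
    change _ = ∑ j ∈ Finset.range G.numPlayers, out (j * G.numArcs + a)
    rw [Finset.sum_range, load, Finset.card_filter]
    exact Finset.sum_congr rfl fun i _ => (hx i a).symm

/-- Loads that minimize the weighted sum of the costs over all integral flows. -/
theorem isSNE_of_minimal {x : G.Profile} (h : ∀ f, G.IsIntegralFlow f →
    G.weightedSum (fun v => (G.factor v : ℝ)) (G.load x) ≤
      G.weightedSum (fun v => (G.factor v : ℝ)) f) : IsSNE G.privateCost x := fun _ z hmove =>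
  absurd (h _ (isIntegralFlow_load z)) (not_le.2 ((separated_factor G).improving
    (fun v _ => by exact_mod_cast factor_pos v) hmove))

open RealRAM in
theorem equilibrium_runs (G : BottleneckRoutingGame) (C : ℕ) (hconv : G.ConvexCosts) {b : ℕ}
    (hb : 2 * (G.size * (G.size + 1)) ≤ b) :
    Runs b Program.equilibrium (G.input C) fun m => ∃ x : G.Profile, G.IsOutput m x ∧
      ∀ f, G.IsIntegralFlow f → G.weightedSum (fun v => (G.factor v : ℝ)) (G.load x) ≤
        G.weightedSum (fun v => (G.factor v : ℝ)) f := by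
  have hs : G.numVertices + G.numArcs + G.numPlayers = G.size := rfl
  have hsb : 2 * G.size ≤ b :=
    (Nat.mul_le_mul_left 2 (Nat.le_mul_of_pos_right _ (Nat.succ_pos _))).trans hb
  have hAn : G.numArcs * (G.numPlayers + 1) ≤ b :=
    (Nat.mul_le_mul (show _ ≤ G.size by omega)
      (show G.numPlayers + 1 ≤ G.size + 1 by omega)).trans (by omega)
  refine Runs.seq ((weights_runs (A := G.numArcs) (n := G.numPlayers) rfl rfl hAn).mono ?_)
  rintro m₁ ⟨h4, hF₁⟩
  -- From here on, the network is the one whose weights the first program has left in array 4; cells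
  -- beyond the cost table are left unspecified.
  have hE : G.IsWeight (m₁.nat 4) := fun a k hk => by
    rw [h4 _ (table_index_lt a hk), ← table_apply a hk]
    rfl
  have hN := hE.valid (C := C) hconv
  have hl : Loaded (G.net C (m₁.nat 4)) m₁ := by
    have h0 : m₁.nat 0 = (G.input C).nat 0 := hF₁.2 0 (by decide)
    constructor <;> first
      | (rw [h0]; rfl)
      | exact hF₁.2 1 (by decide)
      | exact hF₁.2 2 (by decide)
      | rfl
  have hzero : ∀ B, 3 ≤ B → (G.input C).nat B = 0 := fun B hB => by
    ext i
    simp [input, show B ≠ 0 by omega, show B ≠ 1 by omega, show B ≠ 2 by omega]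
  refine Runs.seq ((flowProgram_runs hN hl (b := b) (by change G.numVertices ≤ b; omega)
    (by change 2 * G.numArcs ≤ b; omega) (by change G.numPlayers ≤ b; omega)
    (by rw [hF₁.2 5 (by decide), hzero 5 (by decide)])
    (by rw [hF₁.2 6 (by decide), hzero 6 (by decide)])).mono ?_)
  rintro m₂ ⟨⟨hfeas, hflow, hfn⟩, hF₂⟩
  refine (decompose_runs hN (hl.of_frame hF₂) (b := b) (by change G.numArcs ≤ b; omega)
    (by change G.numPlayers ≤ b; omega)
    ((Nat.mul_le_mul_left _ (Nat.le_succ G.numPlayers)).trans hAn)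
    (by rw [hF₂.2 3 (by decide), hF₁.2 3 (by decide), hzero 3 (by decide)])
    hfeas hflow hfn).mono ?_
  intro m₃ hD
  obtain ⟨x, hx, hload⟩ := exists_profile hN hfeas hfn hD
  refine ⟨x, hx, fun f hf => ?_⟩
  rw [← hE.sum_w (C := C) (load_le x), ← hE.sum_w (C := C) hf.1, Nat.cast_le]
  have hopt := hfeas.optimal hN hflow (hf.isFlow C _) hfn fun a ha => by
    change extend f (⟨a, ha⟩ : Fin G.numArcs) ≤ _
    rw [extend_apply]; exact hf.1 _
  refine le_trans (le_of_eq (Finset.sum_congr rfl fun a ha => ?_)) hopt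
  have ha' : a < G.numArcs := Finset.mem_range.1 ha
  rw [← hload ⟨a, ha'⟩, ← extend_apply (G.load x) ⟨a, ha'⟩]

end BottleneckRoutingGame

theorem mainTheorem12 :
    ∃ prog : RealRAM.Program, ∀ p : Polynomial ℕ, ∃ T : Polynomial ℕ,
      ∀ (G : BottleneckRoutingGame) (C : ℕ), 0 < C → G.ConvexCosts → G.CostsBoundedBy C →
        C ≤ p.eval G.size →
        ∃ (m : RealRAM.Memory) (k : ℕ) (x : G.Profile),
          RealRAM.Exec prog (G.input C) m k ∧ k ≤ T.eval G.size ∧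
          G.IsOutput m x ∧ IsSNE G.privateCost x ∧
          ∀ (δ : ℝ) (M : ℕ), 0 < δ → G.CostGap δ →
            Real.log (G.numPlayers * G.numArcs) * (C / δ) < M →
            (∀ a, ConvexOn ℝ (Set.Icc (0 : ℝ) G.numPlayers) (G.arcPotential C M a)) ∧
            IsGenStrongOrdinalPotential G.privateCost (fun y => G.potential C M (G.load y)) ∧
            G.IsIntegralFlow (G.load x) ∧
            ∀ f, G.IsIntegralFlow f → G.potential C M (G.load x) ≤ G.potential C M f := by
  -- One time polynomial serves every `p`, since the iteration bound does not involve `C`.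
  refine ⟨RealRAM.Program.equilibrium, fun _ =>
    ⟨RealRAM.Program.equilibrium.timePoly (2 * (.X * (.X + 1))), ?_⟩⟩
  intro G C hC hconv hbound _
  obtain ⟨m, k, hexec, hk, x, hout, hmin⟩ := G.equilibrium_runs C hconv le_rfl
  refine ⟨m, k, x, hexec, ?_, hout, BottleneckRoutingGame.isSNE_of_minimal hmin,
    fun δ M hδ hgap hM => ⟨BottleneckRoutingGame.convexOn_arcPotential hconv C M,
      BottleneckRoutingGame.isGenStrongOrdinalPotential hC hbound hδ hgap hM,
      BottleneckRoutingGame.isIntegralFlow_load x, fun f hf => ?_⟩⟩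
  · rw [RealRAM.Program.eval_timePoly]
    simpa using hk
  -- Minimality is transferred from the rank weights, which are positive everywhere, to `(v / C) ^
  -- M`.
  · exact G.separated_factor.weightedSum_le
      (BottleneckRoutingGame.separated_pow hC hbound hδ hgap hM)
      (fun v => by exact_mod_cast BottleneckRoutingGame.factor_pos v)
      (BottleneckRoutingGame.load_le x) hf.1 (hmin f hf)
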